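/- Conventions. For a $C^*$-algebra $A$, $K_0(A)$ is the kernel of $K_0(\tilde A)\to K_0(\mathbb C)$, where $\tilde A=A\oplus\mathbb C$ is $A$ with a unit adjoined, and $K_0$ of a unital algebra is the Grothendieck group of the Murray–von Neumann classes of projections in matrices over it. For a metric space $X$ with a Borel measure $\mu$ and a Hilbert space $H$, the algebra $C_0(X)$ acts on $L^2(X,\mu)\otimes H=L^2(X,\mu;H)$ by multiplication. A bounded operator $T$ on this space is locally compact if $Tf$ and $fT$ are compact for all $f\in C_0(X)$, and has finite propagation if there is $R>0$ such that $fTg=0$ whenever the supports of $f,g\in C_0(X)$ are at distance greater than $R$. The Roe algebra $C^*_H(X)$ is the norm closure of the $*$-algebra of locally compact operators of finite propagation. A discrete space $D$ carries the counting measure. For an isometry $V:\mathbb C\to H$ put $V_D=\mathrm{id}\otimes V:\ell^2(D)\to\ell^2(D)\otimes H$ and $i_D:C^*_{\mathbb C}(D)\to C^*_H(D)$, $i_D(T)=V_DTV_D^*$. Let $C_b(D)$ be the $C^*$-algebra of bounded functions on $D$, and let $\gamma:K_0(C_b(D))\to K_0(C^*_{\mathbb C}(D))$ be induced by the inclusion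 $C_b(D)\subset C^*_{\mathbb C}(D)$ as multiplication operators. Theorem. Let $D$ be a metric space that is uniformly discrete (there is $\varepsilon>0$ with $d(x,y)\ge\varepsilon$ for all $x\ne y$) and of bounded geometry (for every $R>0$ the number of points in the balls of radius $R$ is uniformly bounded). Suppose that $D$ has a ray structure: $D=\bigsqcup_{i\in I}D_i$, and there are bijections $\beta_i:\mathbb N\to D_i$ that are Lipschitz with a constant independent of $i$. Then: (1) for every infinite-dimensional Hilbert space $H$ and every isometry $V:\mathbb C\to H$ one has $(i_D)_*(p)=0$ in $K_0(C^*_H(D))$ for all $p\in\gamma(K_0(C_b(D)))$; in particular $(i_D)_*([1])=0$; (2) let $X$ be a proper metric space with a Borel measure $\mu$ without atoms (points have measure zero) which contains $D$ as a metric subspace, and let $\{\phi_x\}_{x\in D}\subset L^2(X,\mu)$ be a Wannier basis with localization centers in $D$: $\|\phi_x\|_2=1$ and $x\in\operatorname{supp}\phi_x$ for all $x\in D$, $\operatorname{supp}\phi_x\cap\operatorname{supp}\phi_y=\emptyset$ for $x\ne y$, and the diameters of the sets $\operatorname{supp}\phi_x$ are uniformly bounded ($\operatorname{supp}$ being the essential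 support). Then the orthogonal projection $p_\phi$ of $L^2(X,\mu)$ onto the closed linear span of $\{\phi_x\}_{x\in D}$ belongs to $C^*_{\mathbb C}(X)$, and $[p_\phi]=0$ in $K_0(C^*_{\mathbb C}(X))$. -/

import Mathlib

open MeasureTheory
open scoped BoundedContinuousFunction ZeroAtInfty Matrix

noncomputable section

/-! ## Operator K-theory: the group `K₀` of a (not necessarily unital) C⋆-algebra -/

namespace OperatorK

section Monoid

variable (A : Type*) [NonUnitalRing A] [StarRing A]

/-- Projections in the matrix algebras `Mₙ(A)`, `n ∈ ℕ`. -/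
structure ProjMat where
  /-- the size `n` -/
  size : ℕ
  /-- the matrix -/
  mat : Matrix (Fin size) (Fin size) A
  isProj : IsStarProjection mat

variable {A}

/-- Murray–von Neumann equivalence of projections, possibly of different matrix sizes. -/
def MvN (p q : ProjMat A) : Prop :=
  ∃ v : Matrix (Fin p.size) (Fin q.size) A, v * vᴴ = p.mat ∧ vᴴ * v = q.mat

/-- The block diagonal sum `p ⊕ q`. -/
def dsum (p q : ProjMat A) : ProjMat A :=
  ⟨p.size + q.size,
    (Matrix.fromBlocks p.mat 0 0 q.mat).submatrix finSumFinEquiv.symm finSumFinEquiv.symm, by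
      have hp := p.isProj
      have hq := q.isProj
      constructor
      · have h1 := hp.isIdempotentElem.eq
        have h2 := hq.isIdempotentElem.eq
        simp [IsIdempotentElem, Matrix.submatrix_mul_equiv, Matrix.fromBlocks_multiply, h1, h2]
      · have h1 := hp.isSelfAdjoint.star_eq
        have h2 := hq.isSelfAdjoint.star_eq
        rw [Matrix.star_eq_conjTranspose] at h1 h2
        rw [IsSelfAdjoint, Matrix.star_eq_conjTranspose, Matrix.conjTranspose_submatrix,
          Matrix.fromBlocks_conjTranspose, h1, h2]
        simp⟩

variable (A) in
/-- The relations `[p] = [q]` for `p ∼ q` and `[p ⊕ q] = [p] + [q]`. -/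
def relations : Set (FreeAbelianGroup (ProjMat A)) :=
  {x | ∃ p q : ProjMat A, MvN p q ∧ x = FreeAbelianGroup.of p - FreeAbelianGroup.of q} ∪
  {x | ∃ p q : ProjMat A,
    x = FreeAbelianGroup.of (dsum p q) - (FreeAbelianGroup.of p + FreeAbelianGroup.of q)}

variable (A) in
/-- The Grothendieck group of the monoid of Murray–von Neumann classes of projections in matrices
over `A`, presented by generators and relations. For unital `A` this is `K₀(A)`. -/
def K00 : Type _ := FreeAbelianGroup (ProjMat A) ⧸ AddSubgroup.closure (relations A)

instance : AddCommGroup (K00 A) :=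
  inferInstanceAs (AddCommGroup (FreeAbelianGroup (ProjMat A) ⧸ AddSubgroup.closure (relations A)))

variable (A) in
/-- The quotient map from formal integer combinations of projection matrices. -/
def K00.quot : FreeAbelianGroup (ProjMat A) →+ K00 A :=
  QuotientAddGroup.mk' (AddSubgroup.closure (relations A))

theorem K00.quot_surjective : Function.Surjective (K00.quot A) :=
  QuotientAddGroup.mk'_surjective _

theorem K00.quot_eq_zero {x : FreeAbelianGroup (ProjMat A)} (hx : x ∈ relations A) :
    K00.quot A x = 0 :=
  (QuotientAddGroup.eq_zero_iff _).2 (AddSubgroup.subset_closure hx)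

/-- The class of a projection matrix. -/
def K00.mk (p : ProjMat A) : K00 A := K00.quot A (FreeAbelianGroup.of p)

theorem K00.mk_eq_of_mvN {p q : ProjMat A} (h : MvN p q) : K00.mk p = K00.mk q := by
  rw [← sub_eq_zero, K00.mk, K00.mk, ← map_sub]
  exact K00.quot_eq_zero (Or.inl ⟨p, q, h, rfl⟩)

theorem K00.mk_dsum (p q : ProjMat A) : K00.mk (dsum p q) = K00.mk p + K00.mk q := by
  rw [← sub_eq_zero, K00.mk, K00.mk, K00.mk, ← map_add, ← map_sub]
  exact K00.quot_eq_zero (Or.inr ⟨p, q, rfl⟩)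

theorem K00.mk_eq_zero (p : ProjMat A) (h : p.mat = 0) : K00.mk p = 0 := by
  have h1 : MvN (dsum p p) p := by
    refine ⟨0, ?_, ?_⟩
    · have h0 : (Matrix.fromBlocks p.mat 0 0 p.mat).submatrix finSumFinEquiv.symm
          finSumFinEquiv.symm = 0 := by
        rw [h, Matrix.fromBlocks_zero]
        rfl
      rw [Matrix.zero_mul]
      exact h0.symm
    · rw [Matrix.mul_zero, h]
  have h2 := K00.mk_eq_of_mvN h1
  rw [K00.mk_dsum] at h2
  simpa using h2

end Monoid

section Functor

variable {A B : Type*} [NonUnitalRing A] [StarRing A] [Module ℂ A]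
  [NonUnitalRing B] [StarRing B] [Module ℂ B]

/-- Entrywise application of a `*`-homomorphism to a projection matrix. -/
def ProjMat.map (f : A →⋆ₙₐ[ℂ] B) (p : ProjMat A) : ProjMat B :=
  ⟨p.size, p.mat.map f, by
    constructor
    · have h := p.isProj.isIdempotentElem.eq
      rw [IsIdempotentElem, ← Matrix.map_mul, h]
    · have h := p.isProj.isSelfAdjoint.star_eq
      rw [Matrix.star_eq_conjTranspose] at h
      rw [IsSelfAdjoint, Matrix.star_eq_conjTranspose,
        ← Matrix.conjTranspose_map f (fun a => map_star f a), h]⟩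

theorem MvN.map (f : A →⋆ₙₐ[ℂ] B) {p q : ProjMat A} (h : MvN p q) : MvN (p.map f) (q.map f) := by
  obtain ⟨v, h1, h2⟩ := h
  refine ⟨v.map f, ?_, ?_⟩
  · change v.map f * (v.map f)ᴴ = p.mat.map f
    rw [← h1, Matrix.map_mul, Matrix.conjTranspose_map f (fun a => map_star f a)]
  · change (v.map f)ᴴ * v.map f = q.mat.map f
    rw [← h2, Matrix.map_mul, Matrix.conjTranspose_map f (fun a => map_star f a)]

theorem ProjMat.map_dsum (f : A →⋆ₙₐ[ℂ] B) (p q : ProjMat A) :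
    (dsum p q).map f = dsum (p.map f) (q.map f) := by
  have h : ((Matrix.fromBlocks p.mat 0 0 q.mat).submatrix
      finSumFinEquiv.symm finSumFinEquiv.symm).map f
      = (Matrix.fromBlocks (p.mat.map f) 0 0 (q.mat.map f)).submatrix
        finSumFinEquiv.symm finSumFinEquiv.symm := by
    rw [← Matrix.submatrix_map, Matrix.fromBlocks_map]
    simp [Matrix.map_zero]
  simp only [ProjMat.map, dsum, h]
  rfl

/-- The homomorphism induced on Grothendieck groups by a `*`-homomorphism. -/
def K00.map (f : A →⋆ₙₐ[ℂ] B) : K00 A →+ K00 B :=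
  QuotientAddGroup.lift (AddSubgroup.closure (relations A)) (FreeAbelianGroup.lift fun p => K00.mk (p.map f)) (by
    rw [AddSubgroup.closure_le]
    rintro x (⟨p, q, h, rfl⟩ | ⟨p, q, rfl⟩)
    · simp [K00.mk_eq_of_mvN (h.map f)]
    · simp [ProjMat.map_dsum, K00.mk_dsum])

theorem K00.map_mk (f : A →⋆ₙₐ[ℂ] B) (p : ProjMat A) :
    K00.map f (K00.mk p) = K00.mk (p.map f) :=
  FreeAbelianGroup.lift_apply_of _ p

theorem K00.map_comp {C : Type*} [NonUnitalRing C] [StarRing C] [Module ℂ C]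
    (g : B →⋆ₙₐ[ℂ] C) (f : A →⋆ₙₐ[ℂ] B) (x : K00 A) :
    K00.map g (K00.map f x) = K00.map (g.comp f) x := by
  obtain ⟨x, rfl⟩ := K00.quot_surjective x
  induction x using FreeAbelianGroup.induction_on with
  | zero => simp
  | of p =>
    change K00.map g (K00.map f (K00.mk p)) = K00.map (g.comp f) (K00.mk p)
    rw [K00.map_mk, K00.map_mk, K00.map_mk]
    rfl
  | neg p h => simp only [map_neg, h]
  | add x y hx hy => simp only [map_add, hx, hy]

end Functor

section KZero

set_option linter.unusedSectionVars false

variable (A : Type*) [NonUnitalRing A] [StarRing A] [Module ℂ A] [IsScalarTower ℂ A A]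
  [SMulCommClass ℂ A A] [StarModule ℂ A]

/-- The canonical character `Ã = A ⊕ ℂ → ℂ`, `(λ, a) ↦ λ`, of the unitization. -/
def scalarPart : Unitization ℂ A →⋆ₙₐ[ℂ] ℂ where
  toFun x := x.fst
  map_smul' _ _ := rfl
  map_zero' := rfl
  map_add' _ _ := rfl
  map_mul' _ _ := Unitization.fst_mul _ _
  map_star' _ := Unitization.fst_star _

theorem scalarPart_apply (x : Unitization ℂ A) : scalarPart A x = x.fst := rfl

/-- `K₀(A) = ker (K₀(Ã) → K₀(ℂ))`, where `Ã` is the algebra `A` with a unit adjoined. -/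
def K0 : Type _ := (K00.map (scalarPart A)).ker

variable {A} {B : Type*} [NonUnitalRing B] [StarRing B] [Module ℂ B] [IsScalarTower ℂ B B]
  [SMulCommClass ℂ B B] [StarModule ℂ B]

instance : AddCommGroup (K0 A) :=
  inferInstanceAs (AddCommGroup (K00.map (scalarPart A)).ker)

/-- The unital extension `Ã → B̃` of a `*`-homomorphism `A → B`. -/
def unitize (f : A →⋆ₙₐ[ℂ] B) : Unitization ℂ A →⋆ₙₐ[ℂ] Unitization ℂ B :=
  (Unitization.starMap f : Unitization ℂ A →⋆ₐ[ℂ] Unitization ℂ B)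

theorem scalarPart_comp_unitize (f : A →⋆ₙₐ[ℂ] B) :
    (scalarPart B).comp (unitize f) = scalarPart A := by
  ext x
  induction x using Unitization.ind with
  | inl_add_inr r a =>
    simp [unitize, scalarPart_apply, Unitization.algebraMap_eq_inl]

/-- The homomorphism `f_* : K₀(A) → K₀(B)`. -/
def K0.map (f : A →⋆ₙₐ[ℂ] B) : K0 A →+ K0 B :=
  ((K00.map (unitize f)).comp (K00.map (scalarPart A)).ker.subtype).codRestrict
    (K00.map (scalarPart B)).ker (fun x => by
      have hx : K00.map (scalarPart A) x.1 = 0 := x.2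
      rw [AddMonoidHom.mem_ker, AddMonoidHom.comp_apply, K00.map_comp, scalarPart_comp_unitize]
      exact hx)

/-- A projection of `A`, seen as a `1 × 1` projection matrix over `Ã`. -/
def projOne (p : A) (hp : IsStarProjection p) : ProjMat (Unitization ℂ A) :=
  ⟨1, Matrix.of fun _ _ => (p : Unitization ℂ A), by
    constructor
    · refine Matrix.ext fun i j => ?_
      rw [Matrix.mul_apply]
      simp [← Unitization.inr_mul, hp.isIdempotentElem.eq]
    · refine Matrix.ext fun i j => ?_
      rw [Matrix.star_apply]
      simp [← Unitization.inr_star, hp.isSelfAdjoint.star_eq]⟩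

/-- The class `[p] ∈ K₀(A)` of a projection `p ∈ A`. -/
def K0.ofProj (p : A) (hp : IsStarProjection p) : K0 A :=
  ⟨K00.mk (projOne p hp), by
    rw [AddMonoidHom.mem_ker, K00.map_mk]
    apply K00.mk_eq_zero
    refine Matrix.ext fun i j => ?_
    exact Unitization.fst_inr ℂ p⟩

end KZero

end OperatorK

/-! ## Roe algebras -/

namespace Roe

section Mul

variable {X : Type*} [TopologicalSpace X] [MeasurableSpace X] [OpensMeasurableSpace X]
  (μ : Measure X) (H : Type*) [NormedAddCommGroup H] [InnerProductSpace ℂ H]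

theorem memLp_smul (f : X →ᵇ ℂ) (ξ : Lp H 2 μ) : MemLp (fun x => f x • ξ x) 2 μ := by
  refine (Lp.memLp ξ).of_le_mul (c := ‖f‖)
    (f.continuous.aestronglyMeasurable.smul (Lp.aestronglyMeasurable ξ)) ?_
  filter_upwards with x
  rw [norm_smul]
  gcongr
  exact f.norm_coe_le_norm x

/-- Multiplication by a bounded continuous function on `L²(X) ⊗ H = L²(X; H)`. -/
def mulCLM (f : X →ᵇ ℂ) : Lp H 2 μ →L[ℂ] Lp H 2 μ :=
  LinearMap.mkContinuous
    { toFun := fun ξ => (memLp_smul μ H f ξ).toLp _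
      map_add' := fun ξ η => by
        rw [← MemLp.toLp_add]
        refine MemLp.toLp_congr _ _ ?_
        filter_upwards [Lp.coeFn_add ξ η] with x hx
        rw [hx]
        simp
      map_smul' := fun c ξ => by
        rw [RingHom.id_apply, ← MemLp.toLp_const_smul]
        refine MemLp.toLp_congr _ _ ?_
        filter_upwards [Lp.coeFn_smul c ξ] with x hx
        rw [hx]
        simp [smul_comm c] }
    ‖f‖ (fun ξ => by
      refine Lp.norm_le_mul_norm_of_ae_le_mul ?_
      filter_upwards [MemLp.coeFn_toLp (memLp_smul μ H f ξ)] with x hx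
      simp only [LinearMap.coe_mk, AddHom.coe_mk]
      rw [hx, norm_smul]
      gcongr
      exact f.norm_coe_le_norm x)

theorem coeFn_mulCLM (f : X →ᵇ ℂ) (ξ : Lp H 2 μ) :
    mulCLM μ H f ξ =ᵐ[μ] fun x => f x • ξ x :=
  MemLp.coeFn_toLp (memLp_smul μ H f ξ)

theorem norm_mulCLM_le (f : X →ᵇ ℂ) : ‖mulCLM μ H f‖ ≤ ‖f‖ :=
  LinearMap.mkContinuous_norm_le _ (norm_nonneg _) _

variable [CompleteSpace H]

/-- The representation of bounded continuous functions on `L²(X; H)` by multiplication. -/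
def mulRep : (X →ᵇ ℂ) →⋆ₙₐ[ℂ] (Lp H 2 μ →L[ℂ] Lp H 2 μ) where
  toFun := mulCLM μ H
  map_smul' c f := by
    ext1 ξ
    refine Lp.ext ?_
    filter_upwards [coeFn_mulCLM μ H (c • f) ξ, coeFn_mulCLM μ H f ξ,
      Lp.coeFn_smul c (mulCLM μ H f ξ)] with x h1 h2 h3
    simp only [MonoidHom.id_apply, smul_apply]
    rw [h1, h3, Pi.smul_apply, h2]
    simp [smul_smul]
  map_zero' := by
    ext1 ξ
    refine Lp.ext ?_
    filter_upwards [coeFn_mulCLM μ H 0 ξ, Lp.coeFn_zero H 2 μ] with x h1 h2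
    rw [zero_apply, h1, h2]
    simp
  map_add' f g := by
    ext1 ξ
    refine Lp.ext ?_
    filter_upwards [coeFn_mulCLM μ H (f + g) ξ, coeFn_mulCLM μ H f ξ, coeFn_mulCLM μ H g ξ,
      Lp.coeFn_add (mulCLM μ H f ξ) (mulCLM μ H g ξ)] with x h1 h2 h3 h4
    rw [add_apply, h1, h4, Pi.add_apply, h2, h3]
    simp [add_smul]
  map_mul' f g := by
    ext1 ξ
    refine Lp.ext ?_
    filter_upwards [coeFn_mulCLM μ H (f * g) ξ, coeFn_mulCLM μ H f (mulCLM μ H g ξ),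
      coeFn_mulCLM μ H g ξ] with x h1 h2 h3
    rw [mul_apply_eq_comp, h1, h2, h3]
    simp [mul_smul]
  map_star' f := by
    rw [ContinuousLinearMap.star_eq_adjoint, ContinuousLinearMap.eq_adjoint_iff]
    intro ξ η
    rw [L2.inner_def, L2.inner_def]
    refine integral_congr_ae ?_
    filter_upwards [coeFn_mulCLM μ H (star f) ξ, coeFn_mulCLM μ H f η] with x h1 h2
    rw [h1, h2, inner_smul_left, inner_smul_right]
    simp

end Mul

section RoeAlgebra

variable {X : Type*} [MetricSpace X] {E : Type*} [NormedAddCommGroup E] [InnerProductSpace ℂ E]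
  [CompleteSpace E] (ψ : C₀(X, ℂ) →⋆ₙₐ[ℂ] (E →L[ℂ] E))

/-- `T ψ(f)` and `ψ(f) T` are compact for every `f ∈ C₀(X)`. -/
def IsLocallyCompact (T : E →L[ℂ] E) : Prop :=
  ∀ f : C₀(X, ℂ), IsCompactOperator (T * ψ f) ∧ IsCompactOperator (ψ f * T)

/-- For some `R > 0`, `ψ(f) T ψ(g) = 0` whenever the supports of `f, g ∈ C₀(X)` are at distance
greater than `R`. -/
def HasFinitePropagation (T : E →L[ℂ] E) : Prop :=
  ∃ R : ℝ, 0 < R ∧ ∀ f g : C₀(X, ℂ),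
    (∀ x ∈ tsupport f, ∀ y ∈ tsupport g, R < dist x y) → ψ f * T * ψ g = 0

/-- The Roe algebra `C*(X, E)` of a representation `ψ` of `C₀(X)` on a Hilbert space `E`: the norm
closure of the `*`-algebra of locally compact operators of finite propagation. (For a nondegenerate
`ψ` on a proper space these operators already form a `*`-algebra, so that `adjoin` adds nothing.) -/
def roeSubalgebra : NonUnitalStarSubalgebra ℂ (E →L[ℂ] E) :=
  (NonUnitalStarAlgebra.adjoin ℂ
    {T : E →L[ℂ] E | IsLocallyCompact ψ T ∧ HasFinitePropagation ψ T}).topologicalClosure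

theorem mem_roeSubalgebra {T : E →L[ℂ] E} (h1 : IsLocallyCompact ψ T)
    (h2 : HasFinitePropagation ψ T) : T ∈ roeSubalgebra ψ :=
  NonUnitalStarSubalgebra.le_topologicalClosure _
    (NonUnitalStarAlgebra.subset_adjoin ℂ _ ⟨h1, h2⟩)

/-- The Roe algebra as a type, with the operations of the algebra of bounded operators. -/
def RoeAlg : Type _ := roeSubalgebra ψ

instance : NonUnitalRing (RoeAlg ψ) := inferInstanceAs (NonUnitalRing (roeSubalgebra ψ))
instance : StarRing (RoeAlg ψ) := inferInstanceAs (StarRing (roeSubalgebra ψ))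
instance : Module ℂ (RoeAlg ψ) := inferInstanceAs (Module ℂ (roeSubalgebra ψ))
instance : IsScalarTower ℂ (RoeAlg ψ) (RoeAlg ψ) :=
  inferInstanceAs (IsScalarTower ℂ (roeSubalgebra ψ) (roeSubalgebra ψ))
instance : SMulCommClass ℂ (RoeAlg ψ) (RoeAlg ψ) :=
  inferInstanceAs (SMulCommClass ℂ (roeSubalgebra ψ) (roeSubalgebra ψ))
instance : StarModule ℂ (RoeAlg ψ) := inferInstanceAs (StarModule ℂ (roeSubalgebra ψ))

variable {ψ}

/-- An operator in the Roe algebra. -/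
def RoeAlg.mk (T : E →L[ℂ] E) (hT : T ∈ roeSubalgebra ψ) : RoeAlg ψ := ⟨T, hT⟩

variable (ψ) in
/-- The inclusion of the Roe algebra into the bounded operators. -/
def RoeAlg.op : RoeAlg ψ →⋆ₙₐ[ℂ] (E →L[ℂ] E) where
  toFun T := T.1
  map_smul' _ _ := rfl
  map_zero' := rfl
  map_add' _ _ := rfl
  map_mul' _ _ := rfl
  map_star' _ := rfl

theorem RoeAlg.op_mem (T : RoeAlg ψ) : RoeAlg.op ψ T ∈ roeSubalgebra ψ := T.2

theorem RoeAlg.op_mk (T : E →L[ℂ] E) (hT : T ∈ roeSubalgebra ψ) :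
    RoeAlg.op ψ (RoeAlg.mk T hT) = T := rfl

theorem RoeAlg.op_injective : Function.Injective (RoeAlg.op ψ) := Subtype.val_injective

/-- A `*`-homomorphism into bounded operators with values in the Roe algebra. -/
def RoeAlg.lift {A : Type*} [NonUnitalRing A] [StarRing A] [Module ℂ A]
    (f : A →⋆ₙₐ[ℂ] (E →L[ℂ] E)) (hf : ∀ a, f a ∈ roeSubalgebra ψ) : A →⋆ₙₐ[ℂ] RoeAlg ψ where
  toFun a := RoeAlg.mk (f a) (hf a)
  map_smul' c a := RoeAlg.op_injective (map_smul f c a)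
  map_zero' := RoeAlg.op_injective (map_zero f)
  map_add' a b := RoeAlg.op_injective (map_add f a b)
  map_mul' a b := RoeAlg.op_injective (map_mul f a b)
  map_star' a := RoeAlg.op_injective (map_star f a)

end RoeAlgebra

section RoeOfMeasure

variable {X : Type*} [MetricSpace X] [MeasurableSpace X] [BorelSpace X]
  (μ : Measure X) (H : Type*) [NormedAddCommGroup H] [InnerProductSpace ℂ H] [CompleteSpace H]

/-- The action of `C₀(X)` on `L²(X) ⊗ H = L²(X; H)` by multiplication. -/
def act : C₀(X, ℂ) →⋆ₙₐ[ℂ] (Lp H 2 μ →L[ℂ] Lp H 2 μ) where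
  toFun f := mulRep μ H f.toBCF
  map_smul' c f := map_smul (mulRep μ H) c f.toBCF
  map_zero' := map_zero (mulRep μ H)
  map_add' f g := map_add (mulRep μ H) f.toBCF g.toBCF
  map_mul' f g := map_mul (mulRep μ H) f.toBCF g.toBCF
  map_star' f := map_star (mulRep μ H) f.toBCF

theorem act_apply (f : C₀(X, ℂ)) : act μ H f = mulRep μ H f.toBCF := rfl

/-- The Roe algebra `C*_H(X) = C*(X, L²(X) ⊗ H)`. -/
abbrev RoeAlgebra : Type _ := RoeAlg (act μ H)

end RoeOfMeasure

section Conj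

variable {E F : Type*} [NormedAddCommGroup E] [InnerProductSpace ℂ E] [CompleteSpace E]
  [NormedAddCommGroup F] [InnerProductSpace ℂ F] [CompleteSpace F]

/-- `T ↦ W T W*` for an isometry `W`. -/
def conjIsometry (W : E →ₗᵢ[ℂ] F) : (E →L[ℂ] E) →⋆ₙₐ[ℂ] (F →L[ℂ] F) where
  toFun T := W.toContinuousLinearMap ∘L T ∘L
    ContinuousLinearMap.adjoint W.toContinuousLinearMap
  map_smul' c T := by ext; simp
  map_zero' := by ext; simp
  map_add' S T := by ext; simp
  map_mul' S T := by
    have h : ∀ x, ContinuousLinearMap.adjoint W.toContinuousLinearMap (W x) = x := fun x => by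
      refine ext_inner_left ℂ fun y => ?_
      rw [ContinuousLinearMap.adjoint_inner_right]
      simp
    ext x
    simp [h]
  map_star' T := by
    simp [ContinuousLinearMap.star_eq_adjoint, ContinuousLinearMap.adjoint_comp,
      ContinuousLinearMap.comp_assoc]

theorem continuous_conjIsometry (W : E →ₗᵢ[ℂ] F) : Continuous (conjIsometry W) :=
  continuous_const.clm_comp (continuous_id.clm_comp continuous_const)

end Conj

section Stabilize

variable {X : Type*} [MetricSpace X] [MeasurableSpace X] [BorelSpace X]
  (μ : Measure X) {H : Type*} [NormedAddCommGroup H] [InnerProductSpace ℂ H] [CompleteSpace H]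

/-- The isometry `V_X = id ⊗ V : L²(X) → L²(X) ⊗ H` given by an isometry `V : ℂ → H`. -/
def ampl (V : ℂ →ₗᵢ[ℂ] H) : Lp ℂ 2 μ →ₗᵢ[ℂ] Lp H 2 μ where
  toLinearMap := (V.toContinuousLinearMap.compLpL 2 μ).toLinearMap
  norm_map' ξ := by
    rw [Lp.norm_def, Lp.norm_def]
    congr 1
    refine eLpNorm_congr_norm_ae ?_
    filter_upwards [V.toContinuousLinearMap.coeFn_compLpL (p := 2) (μ := μ) ξ] with x hx
    simp only [ContinuousLinearMap.coe_coe]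
    rw [hx]
    simp

theorem act_comp_ampl (V : ℂ →ₗᵢ[ℂ] H) (f : C₀(X, ℂ)) :
    act μ H f ∘L (ampl μ V).toContinuousLinearMap
      = (ampl μ V).toContinuousLinearMap ∘L act μ ℂ f := by
  ext1 ξ
  refine Lp.ext ?_
  filter_upwards [coeFn_mulCLM μ H f.toBCF (ampl μ V ξ),
    V.toContinuousLinearMap.coeFn_compLpL (p := 2) (μ := μ) ξ,
    V.toContinuousLinearMap.coeFn_compLpL (p := 2) (μ := μ) (act μ ℂ f ξ),
    coeFn_mulCLM μ ℂ f.toBCF ξ] with x h1 h2 h3 h4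
  refine h1.trans (Eq.trans ?_ h3.symm)
  refine Eq.trans ?_ (congrArg V h4.symm)
  exact (congrArg (f.toBCF x • ·) h2).trans (V.map_smul _ _).symm

theorem star_act (f : C₀(X, ℂ)) : ContinuousLinearMap.adjoint (act μ H (star f)) = act μ H f := by
  rw [map_star, ContinuousLinearMap.star_eq_adjoint, ContinuousLinearMap.adjoint_adjoint]

theorem adjoint_ampl_comp_act (V : ℂ →ₗᵢ[ℂ] H) (f : C₀(X, ℂ)) :
    ContinuousLinearMap.adjoint (ampl μ V).toContinuousLinearMap ∘L act μ H f
      = act μ ℂ f ∘L ContinuousLinearMap.adjoint (ampl μ V).toContinuousLinearMap := by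
  have h := congrArg ContinuousLinearMap.adjoint (act_comp_ampl μ V (star f))
  rwa [ContinuousLinearMap.adjoint_comp, ContinuousLinearMap.adjoint_comp, star_act,
    star_act] at h

theorem conj_ampl_mul_act (V : ℂ →ₗᵢ[ℂ] H) (T : Lp ℂ 2 μ →L[ℂ] Lp ℂ 2 μ) (f : C₀(X, ℂ)) :
    conjIsometry (ampl μ V) T * act μ H f = conjIsometry (ampl μ V) (T * act μ ℂ f) := by
  have h := adjoint_ampl_comp_act μ V f
  ext1 ξ
  exact congrArg (fun z => ampl μ V (T z)) (DFunLike.congr_fun h ξ)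

theorem act_mul_conj_ampl (V : ℂ →ₗᵢ[ℂ] H) (T : Lp ℂ 2 μ →L[ℂ] Lp ℂ 2 μ) (f : C₀(X, ℂ)) :
    act μ H f * conjIsometry (ampl μ V) T = conjIsometry (ampl μ V) (act μ ℂ f * T) := by
  have h := act_comp_ampl μ V f
  ext1 ξ
  exact DFunLike.congr_fun h _

theorem isCompact_conj {E F : Type*} [NormedAddCommGroup E] [InnerProductSpace ℂ E]
    [CompleteSpace E] [NormedAddCommGroup F] [InnerProductSpace ℂ F] [CompleteSpace F]
    (W : E →ₗᵢ[ℂ] F) {T : E →L[ℂ] E} (hT : IsCompactOperator T) :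
    IsCompactOperator (conjIsometry W T) :=
  (hT.comp_clm (ContinuousLinearMap.adjoint W.toContinuousLinearMap)).clm_comp
    W.toContinuousLinearMap

theorem conj_ampl_mem (V : ℂ →ₗᵢ[ℂ] H) {T : Lp ℂ 2 μ →L[ℂ] Lp ℂ 2 μ}
    (hT : T ∈ roeSubalgebra (act μ ℂ)) : conjIsometry (ampl μ V) T ∈ roeSubalgebra (act μ H) := by
  have key : roeSubalgebra (act μ ℂ) ≤
      (roeSubalgebra (act μ H)).comap (conjIsometry (ampl μ V)) := by
    refine NonUnitalStarSubalgebra.topologicalClosure_minimal _ ?_ ?_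
    · refine NonUnitalStarAlgebra.adjoin_le ?_
      rintro T ⟨h1, R, hR, h2⟩
      refine mem_roeSubalgebra _ (fun f => ⟨?_, ?_⟩) ⟨R, hR, fun f g hfg => ?_⟩
      · change IsCompactOperator (conjIsometry (ampl μ V) T * act μ H f)
        rw [conj_ampl_mul_act]
        exact isCompact_conj _ (h1 f).1
      · change IsCompactOperator (act μ H f * conjIsometry (ampl μ V) T)
        rw [act_mul_conj_ampl]
        exact isCompact_conj _ (h1 f).2
      · change act μ H f * conjIsometry (ampl μ V) T * act μ H g = 0
        rw [act_mul_conj_ampl, conj_ampl_mul_act, h2 f g hfg, map_zero]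
    · exact (NonUnitalStarSubalgebra.isClosed_topologicalClosure _).preimage
        (continuous_conjIsometry _)
  exact key hT

/-- The `*`-homomorphism `i_X : C*_ℂ(X) → C*_H(X)`, `T ↦ V_X T V_X*`. -/
def stabilize (V : ℂ →ₗᵢ[ℂ] H) : RoeAlgebra μ ℂ →⋆ₙₐ[ℂ] RoeAlgebra μ H :=
  RoeAlg.lift ((conjIsometry (ampl μ V)).comp (RoeAlg.op (act μ ℂ)))
    (fun T => conj_ampl_mem μ V T.op_mem)

/-- `(i_X)_* : K₀(C*_ℂ(X)) → K₀(C*_H(X))`. -/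
def iStar (V : ℂ →ₗᵢ[ℂ] H) :
    OperatorK.K0 (RoeAlgebra μ ℂ) →+ OperatorK.K0 (RoeAlgebra μ H) :=
  OperatorK.K0.map (stabilize μ V)

end Stabilize

/-! ## Discrete spaces -/

section Discrete

universe u

/-- Distinct points are at distance at least some `ε > 0`. -/
def UniformlyDiscrete (D : Type*) [MetricSpace D] : Prop :=
  ∃ ε : ℝ, 0 < ε ∧ ∀ x y : D, x ≠ y → ε ≤ dist x y

/-- For every `R > 0` the number of points in the balls of radius `R` is uniformly bounded. -/
def BoundedGeometry (D : Type*) [MetricSpace D] : Prop :=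
  ∀ R : ℝ, 0 < R → ∃ N : ℕ, ∀ x : D, (Metric.closedBall x R).encard ≤ N

/-- `D` is a disjoint union of rays: subsets `Dᵢ` which are images of bijective maps `ℕ → Dᵢ` with
a common Lipschitz constant. -/
def HasRayStructure (D : Type u) [MetricSpace D] : Prop :=
  ∃ (I : Type u) (S : I → Set D) (β : I → ℕ → D) (C : NNReal),
    Pairwise (fun i j => Disjoint (S i) (S j)) ∧ (⋃ i, S i) = Set.univ ∧
    ∀ i, Set.BijOn (β i) Set.univ (S i) ∧ LipschitzWith C (β i)

variable {D : Type*} [MetricSpace D]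

theorem UniformlyDiscrete.discreteTopology (h : UniformlyDiscrete D) : DiscreteTopology D := by
  obtain ⟨ε, hε, h⟩ := h
  exact DiscreteTopology.of_forall_le_dist hε fun x y hxy => h x y hxy

variable [MeasurableSpace D] [BorelSpace D]

variable (D) in
/-- The uniform Roe algebra `C*_ℂ(D)`; points of `D` have measure one. -/
abbrev UniformRoe : Type _ := RoeAlgebra (Measure.count : Measure D) ℂ

theorem isCompactOperator_mulRep_single [DiscreteTopology D] (x : D) (f : D →ᵇ ℂ)
    (hf : ∀ y, y ≠ x → f y = 0) :
    IsCompactOperator (mulRep (Measure.count : Measure D) ℂ f) := by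
  have hx : (Measure.count : Measure D) {x} ≠ ⊤ := by simp
  let e : Lp ℂ 2 (Measure.count : Measure D) :=
    indicatorConstLp 2 (measurableSet_singleton x) hx (1 : ℂ)
  have key : mulRep (Measure.count : Measure D) ℂ f
      = (ContinuousLinearMap.toSpanSingleton ℂ e) ∘L (f x • innerSL ℂ e) := by
    ext1 ξ
    refine Lp.ext ?_
    have hin : inner ℂ e ξ = ξ x := by
      rw [L2.inner_indicatorConstLp_one]
      simp
    filter_upwards [coeFn_mulCLM _ ℂ f ξ, Lp.coeFn_smul (f x * ξ x) e,
      indicatorConstLp_coeFn (p := 2) (hs := measurableSet_singleton x) (hμs := hx)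
        (c := (1 : ℂ))] with y h1 h2 h3
    refine h1.trans ?_
    have h4 : ((ContinuousLinearMap.toSpanSingleton ℂ e) ∘L (f x • innerSL ℂ e)) ξ
        = (f x * ξ x) • e := by
      simp [hin, smul_smul]
    rw [h4, h2, Pi.smul_apply, h3]
    by_cases hy : y = x
    · subst hy; simp
    · simp [hf y hy, hy]
  rw [key]
  exact IsCompactOperator.clm_comp (M₂ := ℂ)
    (isCompactOperator_of_locallyCompactSpace_dom (f x • innerSL ℂ e)) (ContinuousLinearMap.toSpanSingleton ℂ e)

theorem isCompactOperator_mulRep_finite [DiscreteTopology D] (s : Finset D) (f : D →ᵇ ℂ)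
    (hf : ∀ y, y ∉ s → f y = 0) :
    IsCompactOperator (mulRep (Measure.count : Measure D) ℂ f) := by
  classical
  induction s using Finset.induction_on generalizing f with
  | empty =>
    have : f = 0 := by ext y; simpa using hf y (by simp)
    rw [this, map_zero]
    exact isCompactOperator_zero
  | insert x s hx ih =>
    let g : D →ᵇ ℂ := BoundedContinuousFunction.ofNormedAddCommGroup
      (fun y => if y = x then f y else 0) continuous_of_discreteTopology ‖f‖ (fun y => by
        split_ifs
        · exact f.norm_coe_le_norm y
        · simp)
    have hg : ∀ y, g y = if y = x then f y else 0 := fun y => rfl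
    have h1 := isCompactOperator_mulRep_single x g (fun y hy => by simp [hg, hy])
    have h2 := ih (f - g) (fun y hy => by
      by_cases hyx : y = x
      · simp [hg, hyx]
      · simp [hg, hyx, hf y (by simp [hyx, hy])])
    have : mulRep (Measure.count : Measure D) ℂ f = mulRep (Measure.count : Measure D) ℂ g
        + mulRep (Measure.count : Measure D) ℂ (f - g) := by
      rw [← map_add]; congr 1; abel
    rw [this]
    exact h1.add h2

theorem isCompactOperator_act [DiscreteTopology D] (f : C₀(D, ℂ)) :
    IsCompactOperator (act (Measure.count : Measure D) ℂ f) := by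
  classical
  suffices h : act (Measure.count : Measure D) ℂ f ∈ closure
      {T : Lp ℂ 2 (Measure.count : Measure D) →L[ℂ] Lp ℂ 2 (Measure.count : Measure D) |
        IsCompactOperator T} by
    rwa [IsClosed.closure_eq isClosed_setOfPred_isCompactOperator] at h
  rw [Metric.mem_closure_iff]
  intro ε hε
  have hfin : {x : D | ε / 2 ≤ ‖f x‖}.Finite := by
    have h := f.zero_at_infty'
    rw [Filter.cocompact_eq_cofinite] at h
    have h' := Metric.tendsto_nhds.1 h (ε / 2) (half_pos hε)
    rw [Filter.eventually_cofinite] at h'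
    refine h'.subset fun x hx => ?_
    simpa using hx
  let g : D →ᵇ ℂ := BoundedContinuousFunction.ofNormedAddCommGroup
    (fun y => if y ∈ hfin.toFinset then f y else 0) continuous_of_discreteTopology ‖f.toBCF‖
    (fun y => by
      split_ifs
      · exact f.toBCF.norm_coe_le_norm y
      · simp)
  have hg : ∀ y, g y = if y ∈ hfin.toFinset then f y else 0 := fun y => rfl
  refine ⟨mulRep _ ℂ g, isCompactOperator_mulRep_finite hfin.toFinset g
    (fun y hy => by rw [hg, if_neg hy]), ?_⟩
  rw [dist_eq_norm, act_apply, ← map_sub]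
  refine (norm_mulCLM_le _ ℂ _).trans_lt (lt_of_le_of_lt ?_ (half_lt_self hε))
  rw [BoundedContinuousFunction.norm_le (half_pos hε).le]
  intro y
  have hf : f.toBCF y = f y := rfl
  by_cases hy : ε / 2 ≤ ‖f y‖
  · simp [hg, hy, hf, (half_pos hε).le]
  · simp [hg, hy, hf, (not_le.1 hy).le]

theorem mulRep_mem_uniformRoe [DiscreteTopology D] (f : D →ᵇ ℂ) :
    mulRep (Measure.count : Measure D) ℂ f ∈ roeSubalgebra (act (Measure.count : Measure D) ℂ) := by
  refine mem_roeSubalgebra _ (fun g => ⟨?_, ?_⟩) ⟨1, one_pos, fun g h hgh => ?_⟩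
  · exact (isCompactOperator_act g).clm_comp (mulRep (Measure.count : Measure D) ℂ f)
  · exact (isCompactOperator_act g).comp_clm (mulRep (Measure.count : Measure D) ℂ f)
  · rw [act_apply, act_apply, ← map_mul, ← map_mul]
    have : g.toBCF * f * h.toBCF = 0 := by
      ext x
      by_contra hne
      have h1 : g x ≠ 0 := fun h0 => hne (by
        have : g.toBCF x = 0 := h0
        simp [this])
      have h2 : h x ≠ 0 := fun h0 => hne (by
        have : h.toBCF x = 0 := h0
        simp [this])
      have := hgh x (subset_tsupport _ h1) x (subset_tsupport _ h2)
      simp at this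
      linarith
    rw [this, map_zero]

/-- The inclusion `C_b(D) ⊂ C*_ℂ(D)` as multiplication operators. -/
def diagonal (hD : UniformlyDiscrete D) : (D →ᵇ ℂ) →⋆ₙₐ[ℂ] UniformRoe D :=
  RoeAlg.lift (mulRep (Measure.count : Measure D) ℂ)
    (fun f => by
      have := hD.discreteTopology
      exact mulRep_mem_uniformRoe f)

/-- `γ : K₀(C_b(D)) → K₀(C*_ℂ(D))`. -/
def gamma (hD : UniformlyDiscrete D) : OperatorK.K0 (D →ᵇ ℂ) →+ OperatorK.K0 (UniformRoe D) :=
  OperatorK.K0.map (diagonal hD)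

theorem one_mem_uniformRoe (hD : UniformlyDiscrete D) :
    (1 : Lp ℂ 2 (Measure.count : Measure D) →L[ℂ] Lp ℂ 2 (Measure.count : Measure D))
      ∈ roeSubalgebra (act (Measure.count : Measure D) ℂ) := by
  have := hD.discreteTopology
  have h : mulRep (Measure.count : Measure D) ℂ 1 = 1 := by
    ext1 ξ
    refine Lp.ext ?_
    filter_upwards [coeFn_mulCLM Measure.count ℂ 1 ξ] with x hx
    refine hx.trans ?_
    simp
  rw [← h]
  exact mulRep_mem_uniformRoe 1

/-- The unit `1 ∈ C*_ℂ(D)`. -/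
def unit (hD : UniformlyDiscrete D) : UniformRoe D :=
  RoeAlg.mk 1 (one_mem_uniformRoe hD)

theorem isStarProjection_unit (hD : UniformlyDiscrete D) : IsStarProjection (unit hD) :=
  ⟨RoeAlg.op_injective (one_mul _), RoeAlg.op_injective (star_one _)⟩

end Discrete

/-! ## Wannier bases -/

section Wannier

variable {X : Type*} [MetricSpace X] [MeasurableSpace X] [BorelSpace X] {μ : Measure X}

/-- The (essential) support of an `L²` function: the complement of the largest open set on which
it vanishes almost everywhere. -/
def supp (φ : Lp ℂ 2 μ) : Set X :=
  {x | ∀ U : Set X, IsOpen U → x ∈ U → ¬ ∀ᵐ y ∂μ, y ∈ U → φ y = 0}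

/-- A compactly supported Wannier basis in `L²(X)` with localization centers in `D`, where `D` is
regarded as a subspace of `X` through `ι`. -/
def IsWannierBasis {D : Type*} (ι : D → X) (φ : D → Lp ℂ 2 μ) : Prop :=
  (∀ x y, x ≠ y → Disjoint (supp (φ x)) (supp (φ y))) ∧
  (∀ x, ι x ∈ supp (φ x)) ∧
  (∃ C : ℝ, ∀ x, ∀ y ∈ supp (φ x), ∀ z ∈ supp (φ x), dist y z ≤ C) ∧
  ∀ x, ‖φ x‖ = 1

/-- The orthogonal projection `p_φ` onto the closed linear span `H_φ` of the `φ x`. -/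
def wannierProj {D : Type*} (φ : D → Lp ℂ 2 μ) : Lp ℂ 2 μ →L[ℂ] Lp ℂ 2 μ :=
  (Submodule.span ℂ (Set.range φ)).topologicalClosure.starProjection

end Wannier

end Roe

end

/-! The argument is an Eilenberg swindle: along each ray there is room to push a projection off to
infinity. Let `e (y, k)` be an orthonormal family with infinitely many vectors near each point `y`
of `D`, and let `σ` be the shift by one step along the rays. Spread the vector at `y` along its ray
by putting `ε (y, k) = e (σ^k y, k)`; the label `k` keeps the copies that land on the same point
orthogonal. For a bounded function `c` on `D` let `f c` be the diagonal operator with entry `c y` at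
every `ε (y, k)`, and split it into `f₀ c` (the terms `k = 0`) and `f₁ c` (the terms `k ≥ 1`). The
isometric shift `ε (y, k) ↦ ε (y, k + 1)` conjugates `f` to `f₁`, so `f` and `f₁` agree on K-theory;
as `f = f₀ + f₁` orthogonally, `f₀` is zero on K-theory.

Two facts keep everything inside the Roe algebra. A point at position `n` of its ray is reached only
by shifts with `k ≤ n`, so with bounded geometry only finitely many `ε (y, k)` are centred in a
bounded set, which gives local compactness. The shift moves centres by at most the Lipschitz
constant of the rays, which gives finite propagation. These are `sandwich_mem_roeSubalgebra` and
`exists_hom_map_eq_zero`; the K-theoretic half is `K0.map_eq_zero_of_swindle`.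

For part (1), `f₀` is the composite of the diagonal inclusion and stabilization once `V 1` is
completed to an orthonormal sequence of `H`. For part (2), `f₀ 1` is the Wannier projection; the
extra vectors are found among functions living where `φ x` is nonzero, an infinite-dimensional space
because the measure has no atoms. -/

noncomputable section

namespace OperatorK

set_option linter.unusedSectionVars false

/-! ### Orthogonal sums and conjugation on Grothendieck groups of projections. -/

section Additivity

variable {A B : Type*} [NonUnitalRing A] [StarRing A] [Module ℂ A]
  [NonUnitalRing B] [StarRing B] [Module ℂ B]

theorem K00.hom_ext {G : Type*} [AddCommGroup G] {f g : K00 A →+ G}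
    (h : ∀ p, f (K00.mk p) = g (K00.mk p)) : f = g := by
  ext x
  obtain ⟨x, rfl⟩ := K00.quot_surjective x
  induction x using FreeAbelianGroup.induction_on with
  | zero => simp
  | of p => exact h p
  | neg p h => simp only [map_neg, h]
  | add x y hx hy => simp only [map_add, hx, hy]

theorem ProjMat.sum_mul_apply (p : ProjMat A) (i j : Fin p.size) :
    ∑ k, p.mat i k * p.mat k j = p.mat i j := by
  rw [← Matrix.mul_apply, p.isProj.isIdempotentElem.eq]

theorem ProjMat.star_apply (p : ProjMat A) (i j : Fin p.size) :
    star (p.mat i j) = p.mat j i := by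
  conv_rhs => rw [← p.isProj.isSelfAdjoint.star_eq]
  rw [Matrix.star_apply]

/-- The row `(p q)` implements the equivalence: multiplied by its adjoint on one side it gives the
sum, and on the other the block matrix, whose off-diagonal blocks vanish by orthogonality. -/
theorem mvN_sum {n : ℕ} {p q : Matrix (Fin n) (Fin n) B} (hp : p * p = p) (hp' : pᴴ = p)
    (hq : q * q = q) (hq' : qᴴ = q) (hpq : p * q = 0) (hqp : q * p = 0) :
    ∃ v : Matrix (Fin n) (Fin (n + n)) B, v * vᴴ = p + q ∧
      vᴴ * v = (Matrix.fromBlocks p 0 0 q).submatrix finSumFinEquiv.symm finSumFinEquiv.symm := by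
  have h1 : Matrix.fromCols p q * Matrix.fromRows pᴴ qᴴ = p * pᴴ + q * qᴴ := by
    ext i j; simp [Matrix.mul_apply]
  have h2 : Matrix.fromRows pᴴ qᴴ * Matrix.fromCols p q
      = Matrix.fromBlocks (pᴴ * p) (pᴴ * q) (qᴴ * p) (qᴴ * q) := by
    ext (i | i) (j | j) <;> simp [Matrix.mul_apply]
  refine ⟨(Matrix.fromCols p q).submatrix id finSumFinEquiv.symm, ?_, ?_⟩
  · rw [Matrix.conjTranspose_submatrix, Matrix.submatrix_mul_equiv,
      Matrix.conjTranspose_fromCols_eq_fromRows_conjTranspose, h1,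
      hp', hq', hp, hq, Matrix.submatrix_id_id]
  · rw [Matrix.conjTranspose_submatrix, ← Matrix.submatrix_mul _ _ _ id _ Function.bijective_id,
      Matrix.conjTranspose_fromCols_eq_fromRows_conjTranspose, h2,
      hp', hq', hp, hq, hpq, hqp]

theorem K00.map_eq_map_add_map {f g h : A →⋆ₙₐ[ℂ] B} (hadd : ∀ a, f a = g a + h a)
    (horth : ∀ a b, g a * h b = 0) : K00.map f = K00.map g + K00.map h := by
  have horth' : ∀ a b, h a * g b = 0 := fun a b => by
    have := congrArg star (horth (star b) (star a))
    simpa [← map_star] using this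
  refine K00.hom_ext fun p => ?_
  rw [AddMonoidHom.add_apply, K00.map_mk, K00.map_mk, K00.map_mk, ← K00.mk_dsum]
  obtain ⟨v, h1, h2⟩ := mvN_sum (p := p.mat.map g) (q := p.mat.map h)
    (p.map g).isProj.isIdempotentElem.eq (p.map g).isProj.isSelfAdjoint.star_eq
    (p.map h).isProj.isIdempotentElem.eq (p.map h).isProj.isSelfAdjoint.star_eq
    (by ext i j; simp [Matrix.mul_apply, horth]) (by ext i j; simp [Matrix.mul_apply, horth'])
  refine K00.mk_eq_of_mvN ⟨v, h1.trans ?_, h2⟩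
  exact Matrix.ext fun i j => (hadd _).symm

/-- For a projection matrix `p`, the matrix `v f(p)` is a partial isometry from `f(p)` to `g(p)`.
Only the behaviour of `star v * v` on the image of `f` matters, so `v` itself need not be an
isometry. -/
theorem K00.map_eq_of_conj {f g : A →⋆ₙₐ[ℂ] B} (v : B)
    (hg : ∀ a, v * f a * star v = g a) (hf : ∀ a, star v * v * f a = f a) :
    K00.map f = K00.map g := by
  refine K00.hom_ext fun p => ?_
  rw [K00.map_mk, K00.map_mk]
  symm
  let w : Matrix (Fin p.size) (Fin p.size) B := Matrix.of fun i j => v * f (p.mat i j)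
  have h1 : w * wᴴ = p.mat.map g := by
    ext i j
    rw [Matrix.mul_apply, Matrix.map_apply, ← hg, ← p.sum_mul_apply, map_sum, Finset.mul_sum,
      Finset.sum_mul]
    refine Finset.sum_congr rfl fun k _ => ?_
    simp [w, ← map_star, p.star_apply, mul_assoc]
  have h2 : wᴴ * w = p.mat.map f := by
    ext i j
    rw [Matrix.mul_apply, Matrix.map_apply, ← p.sum_mul_apply, map_sum]
    refine Finset.sum_congr rfl fun k _ => ?_
    have := hf (p.mat k j)
    simp only [w, Matrix.conjTranspose_apply, Matrix.of_apply, star_mul, ← map_star, p.star_apply]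
    rw [mul_assoc, ← mul_assoc (star v), this, map_mul]
  exact K00.mk_eq_of_mvN ⟨w, h1, h2⟩

end Additivity

/-! ### The swindle on `K₀`, with the bookkeeping for adjoined units. -/

section Swindle

variable {A B : Type*} [NonUnitalRing A] [StarRing A] [Module ℂ A] [IsScalarTower ℂ A A]
  [SMulCommClass ℂ A A] [StarModule ℂ A]
  [NonUnitalRing B] [StarRing B] [Module ℂ B] [IsScalarTower ℂ B B]
  [SMulCommClass ℂ B B] [StarModule ℂ B]

theorem unitize_apply (f : A →⋆ₙₐ[ℂ] B) (x : Unitization ℂ A) :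
    unitize f x = Unitization.inl x.fst + ((f x.snd : B) : Unitization ℂ B) := by
  induction x using Unitization.ind with
  | inl_add_inr r a => simp [unitize, Unitization.algebraMap_eq_inl]

variable (A) in
/-- For `e` a unit of `A`, the retraction `Ã → A`, `(λ, a) ↦ λ e + a`. -/
def unitRetract (e : A) (he : ∀ a, e * a = a) (he' : ∀ a, a * e = a) (hs : star e = e) :
    Unitization ℂ A →⋆ₙₐ[ℂ] A where
  toFun x := x.fst • e + x.snd
  map_smul' c x := by simp [smul_smul]
  map_zero' := by simp
  map_add' x y := by simp [add_smul]; abel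
  map_mul' x y := by
    have h : x.fst • e * y.fst • e = (x.fst * y.fst) • e := by
      rw [smul_mul_smul_comm, he]
    have h1 : x.snd * y.fst • e = y.fst • x.snd := by rw [mul_smul_comm, he']
    have h2 : x.fst • e * y.snd = x.fst • y.snd := by rw [smul_mul_assoc, he]
    simp only [Unitization.fst_mul, Unitization.snd_mul, add_mul, mul_add, h, h1, h2]
    abel
  map_star' x := by simp [hs]

/-- The inclusion `B → B̃`. -/
def inrHom (B : Type*) [NonUnitalRing B] [StarRing B] [Module ℂ B] :
    B →⋆ₙₐ[ℂ] Unitization ℂ B := Unitization.inrNonUnitalStarAlgHom ℂ B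

/-- For a projection `e ∈ B`, the homomorphism `ℂ → B̃`, `λ ↦ λ (1 - e)`. -/
def complHom (e : B) (he : IsStarProjection e) : ℂ →⋆ₙₐ[ℂ] Unitization ℂ B where
  toFun c := c • (1 - (e : Unitization ℂ B))
  map_smul' c x := by simp [smul_smul]
  map_zero' := by simp
  map_add' x y := by rw [add_smul]
  map_mul' x y := by
    have h : (e : Unitization ℂ B) * e = e := by
      rw [← Unitization.inr_mul, he.isIdempotentElem.eq]
    rw [smul_mul_smul_comm]
    congr 1
    simp [sub_mul, mul_sub, h]
  map_star' x := by
    have h : star (e : Unitization ℂ B) = e := by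
      rw [← Unitization.inr_star, he.isSelfAdjoint.star_eq]
    rw [star_smul, star_sub, star_one, h]

/-- Eilenberg swindle: if `f = f₀ + f₁` with `f₀`, `f₁` orthogonal and `f` is conjugate to `f₁`,
then `f₀` vanishes on `K₀`. -/
theorem K0.map_eq_zero_of_swindle (e : A) (he : ∀ a, e * a = a) (he' : ∀ a, a * e = a)
    (hs : star e = e) {f f₀ f₁ : A →⋆ₙₐ[ℂ] B} (hadd : ∀ a, f a = f₀ a + f₁ a)
    (horth : ∀ a b, f₀ a * f₁ b = 0) (v : B) (hg : ∀ a, v * f a * star v = f₁ a)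
    (hf : ∀ a, star v * v * f a = f a) (z : K0 A) : K0.map f₀ z = 0 := by
  let r := unitRetract A e he he' hs
  -- The unital extensions of `f₀` and `f₁` are not orthogonal, so the swindle is run on these
  -- non-unital extensions, which send everything into `B`.
  let F (k : A →⋆ₙₐ[ℂ] B) : Unitization ℂ A →⋆ₙₐ[ℂ] Unitization ℂ B := (inrHom B).comp (k.comp r)
  have hF : ∀ k x, F k x = ((k (r x) : B) : Unitization ℂ B) := fun _ _ => rfl
  have h1 : K00.map (F f) = K00.map (F f₀) + K00.map (F f₁) :=
    K00.map_eq_map_add_map (fun a => by simp [hF, hadd])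
      (fun a b => by simp [hF, ← Unitization.inr_mul, horth])
  have h2 : K00.map (F f) = K00.map (F f₁) :=
    K00.map_eq_of_conj (v : Unitization ℂ B)
      (fun a => by rw [hF, hF, ← hg, ← Unitization.inr_star, ← Unitization.inr_mul,
        ← Unitization.inr_mul])
      (fun a => by rw [hF, ← Unitization.inr_star, ← Unitization.inr_mul, ← Unitization.inr_mul,
        hf])
  have h3 : K00.map (F f₀) = 0 := by simpa [h2] using h1
  have hp : IsStarProjection (f₀ e) := ⟨by rw [IsIdempotentElem, ← map_mul, he],
    by rw [IsSelfAdjoint, ← map_star, hs]⟩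
  -- `unitize f₀` differs from `F f₀` only by this homomorphism, which is orthogonal to `F f₀` and
  -- factors through the scalar part. Hence it vanishes on `K₀(A)`, the kernel of the scalar part.
  let G := (complHom (f₀ e) hp).comp (scalarPart A)
  have hG : ∀ x, G x = x.fst • (1 - (f₀ e : Unitization ℂ B)) := fun _ => rfl
  have hr : ∀ x, r x = x.fst • e + x.snd := fun _ => rfl
  have h4 : K00.map (unitize f₀) = K00.map (F f₀) + K00.map G := by
    refine K00.map_eq_map_add_map (fun x => ?_) (fun x y => ?_)
    · have h : (Unitization.inl x.fst : Unitization ℂ B) = x.fst • 1 := by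
        ext <;> simp
      rw [unitize_apply, hF, hG, hr, map_add, map_smul, Unitization.inr_add, Unitization.inr_smul,
        smul_sub, h]
      abel
    · rw [hF, hG, mul_smul_comm, mul_sub, mul_one, ← Unitization.inr_mul, ← map_mul, he', sub_self,
        smul_zero]
  refine Subtype.ext ?_
  change K00.map (unitize f₀) z.1 = 0
  rw [h4, h3, zero_add, ← K00.map_comp]
  have hz : K00.map (scalarPart A) z.1 = 0 := z.2
  rw [hz, map_zero]

theorem K0.map_ofProj (f : A →⋆ₙₐ[ℂ] B) (p : A) (hp : IsStarProjection p) (q : B)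
    (hq : IsStarProjection q) (h : f p = q) :
    K0.map f (K0.ofProj p hp) = K0.ofProj q hq := by
  subst h
  refine Subtype.ext ?_
  change K00.map (unitize f) (K00.mk (projOne p hp)) = K00.mk (projOne (f p) hq)
  rw [K00.map_mk]
  congr 1
  have h : (projOne p hp).mat.map (unitize f) = (projOne (f p) hq).mat := by
    refine Matrix.ext fun i j => ?_
    change unitize f (p : Unitization ℂ A) = ((f p : B) : Unitization ℂ B)
    simp [unitize_apply]
  simp only [ProjMat.map, h]
  rfl

theorem K0.map_map {C : Type*} [NonUnitalRing C] [StarRing C] [Module ℂ C] [IsScalarTower ℂ C C]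
    [SMulCommClass ℂ C C] [StarModule ℂ C] (g : B →⋆ₙₐ[ℂ] C) (f : A →⋆ₙₐ[ℂ] B) (z : K0 A) :
    K0.map g (K0.map f z) = K0.map (g.comp f) z := by
  refine Subtype.ext ?_
  change K00.map (unitize g) (K00.map (unitize f) z.1) = K00.map (unitize (g.comp f)) z.1
  have h : (unitize g).comp (unitize f) = unitize (g.comp f) := by
    refine NonUnitalStarAlgHom.ext fun x => ?_
    simp [unitize_apply]
  rw [K00.map_comp, h]

end Swindle

end OperatorK

end

noncomputable section

/-! ### Orthonormal sequences with a prescribed first vector. -/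

section Orthonormal

variable {E : Type*} [NormedAddCommGroup E] [InnerProductSpace ℂ E]

/-- In an infinite-dimensional inner product space every unit vector is the first member of an
orthonormal sequence. -/
theorem exists_orthonormal_nat_extending (h : ¬ FiniteDimensional ℂ E) (u : E) (hu : ‖u‖ = 1) :
    ∃ e : ℕ → E, Orthonormal ℂ e ∧ e 0 = u := by
  classical
  have hs : Orthonormal ℂ ((↑) : ({u} : Set E) → E) := by
    refine ⟨fun i => ?_, fun i j hij => ?_⟩
    · obtain ⟨i, rfl⟩ := i
      exact hu
    · exact absurd (Subsingleton.elim i j) hij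
  obtain ⟨w, hw, hwo, hmax⟩ := exists_maximal_orthonormal hs
  -- A finite maximal orthonormal set has a complete span with zero orthogonal complement, so it
  -- spans the whole space.
  have hinf : w.Infinite := by
    intro hfin
    apply h
    have := (maximal_orthonormal_iff_orthogonalComplement_eq_bot hwo).1 hmax
    have hfd : FiniteDimensional ℂ (Submodule.span ℂ w) := FiniteDimensional.span_of_finite ℂ hfin
    rw [Submodule.orthogonal_eq_bot_iff] at this
    rw [this] at hfd
    exact Module.finite_def.2 (Module.Finite.iff_fg.1 hfd)
  have huw : u ∈ w := hw rfl
  let g := (hinf.sdiff (Set.finite_singleton u)).natEmbedding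
  have hg : ∀ n, (g n : E) ∈ w ∧ (g n : E) ≠ u := fun n => ⟨(g n).2.1, fun hn => (g n).2.2 hn⟩
  let k : ℕ → w := fun n => match n with
    | 0 => ⟨u, huw⟩
    | n + 1 => ⟨g n, (hg n).1⟩
  refine ⟨fun n => k n, hwo.comp k ?_, rfl⟩
  rintro (_ | m) (_ | n) hmn
  · rfl
  · exact absurd (congrArg Subtype.val hmn).symm (hg n).2
  · exact absurd (congrArg Subtype.val hmn) (hg m).2
  · have := congrArg Subtype.val hmn
    rw [g.injective (Subtype.ext this)]

end Orthonormal

namespace Roe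

/-! ### Coordinates on `ℓ²(J)` and operators diagonal between two orthonormal families. -/

section Discrete

variable {J : Type*} [TopologicalSpace J] [DiscreteTopology J] [MeasurableSpace J]
  [OpensMeasurableSpace J]

theorem count_singleton_ne_top (j : J) : (Measure.count : Measure J) {j} ≠ ⊤ := by
  rw [Measure.count_singleton' (isOpen_discrete {j}).measurableSet]
  exact ENNReal.one_ne_top

/-- The unit vector `δ_j ∈ ℓ²(J)`. -/
def delta (j : J) : Lp ℂ 2 (Measure.count : Measure J) :=
  indicatorConstLp 2 (isOpen_discrete {j}).measurableSet (count_singleton_ne_top j) (1 : ℂ)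

theorem inner_delta (j : J) (ξ : Lp ℂ 2 (Measure.count : Measure J)) :
    inner ℂ (delta j) ξ = ξ j := by
  have : MeasurableSingletonClass J := ⟨fun j => (isOpen_discrete {j}).measurableSet⟩
  rw [delta, L2.inner_indicatorConstLp_one]
  simp

/-- Only the empty set is null for counting measure; this allows pointwise computation with elements
of `ℓ²(J)`. -/
theorem ae_count_iff {p : J → Prop} : (∀ᵐ j ∂(Measure.count : Measure J), p j) ↔ ∀ j, p j := by
  have : MeasurableSingletonClass J := ⟨fun j => (isOpen_discrete {j}).measurableSet⟩
  refine ⟨fun h j => ?_, fun h => Filter.Eventually.of_forall h⟩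
  by_contra hj
  rw [ae_iff, Measure.count_eq_zero_iff] at h
  exact (h ▸ hj : j ∈ (∅ : Set J))

theorem delta_apply [DecidableEq J] (i j : J) : delta i j = if i = j then 1 else 0 := by
  have h := ae_count_iff.1 (indicatorConstLp_coeFn (p := 2)
    (hs := (isOpen_discrete {i}).measurableSet) (hμs := count_singleton_ne_top i) (c := (1 : ℂ))) j
  refine h.trans ?_
  simp [Set.indicator_apply, eq_comm]

theorem orthonormal_delta : Orthonormal ℂ (delta : J → _) := by
  classical
  rw [orthonormal_iff_ite]
  intro i j
  rw [inner_delta, delta_apply]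
  simp [eq_comm]

/-- The standard orthonormal basis of `ℓ²(J)`. -/
def deltaBasis : HilbertBasis J ℂ (Lp ℂ 2 (Measure.count : Measure J)) :=
  HilbertBasis.mkOfOrthogonalEqBot orthonormal_delta (by
    rw [Submodule.eq_bot_iff]
    intro ξ hξ
    refine Lp.ext (ae_count_iff.2 fun j => ?_)
    rw [← inner_delta, (Submodule.mem_orthogonal _ _).1 hξ _ (Submodule.subset_span ⟨j, rfl⟩),
      ae_count_iff.1 (Lp.coeFn_zero ℂ 2 _) j]
    rfl)

theorem coe_deltaBasis : ⇑(deltaBasis : HilbertBasis J ℂ _) = delta :=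
  HilbertBasis.coe_mkOfOrthogonalEqBot _ _

theorem hasSum_delta (ξ : Lp ℂ 2 (Measure.count : Measure J)) :
    HasSum (fun j => ξ j • delta j) ξ := by
  have h := (deltaBasis (J := J)).hasSum_repr ξ
  simpa only [HilbertBasis.repr_apply_apply, coe_deltaBasis, inner_delta] using h

theorem mulRep_count_apply (c : J →ᵇ ℂ) (ξ : Lp ℂ 2 (Measure.count : Measure J)) (j : J) :
    mulRep Measure.count ℂ c ξ j = c j * ξ j :=
  ae_count_iff.1 (coeFn_mulCLM Measure.count ℂ c ξ) j

theorem mulRep_count_delta (c : J →ᵇ ℂ) (j : J) :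
    mulRep Measure.count ℂ c (delta j) = c j • delta j := by
  classical
  refine Lp.ext (ae_count_iff.2 fun i => ?_)
  rw [mulRep_count_apply, ae_count_iff.1 (Lp.coeFn_smul (c j) (delta j)) i, Pi.smul_apply,
    delta_apply]
  by_cases h : j = i
  · simp [h]
  · simp [h]

variable {E : Type*} [NormedAddCommGroup E] [InnerProductSpace ℂ E] [CompleteSpace E]

/-- The isometry `ℓ²(J) → E`, `δ_j ↦ ε_j`, of an orthonormal family `ε`. -/
def frame {ε : J → E} (hε : Orthonormal ℂ ε) : Lp ℂ 2 (Measure.count : Measure J) →ₗᵢ[ℂ] E :=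
  hε.orthogonalFamily.linearIsometry.comp (deltaBasis (J := J)).repr.toLinearIsometry

theorem frame_delta {ε : J → E} (hε : Orthonormal ℂ ε) (j : J) : frame hε (delta j) = ε j := by
  classical
  rw [← coe_deltaBasis]
  change hε.orthogonalFamily.linearIsometry (deltaBasis.repr (deltaBasis j)) = _
  rw [HilbertBasis.repr_self, OrthogonalFamily.linearIsometry_apply_single]
  simp

theorem eq_of_delta {F : Type*} [NormedAddCommGroup F] [NormedSpace ℂ F]
    {S T : Lp ℂ 2 (Measure.count : Measure J) →L[ℂ] F} (h : ∀ j, S (delta j) = T (delta j)) :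
    S = T := by
  ext1 ξ
  refine ((hasSum_delta ξ).mapL S).unique ?_
  simpa only [map_smul, h] using (hasSum_delta ξ).mapL T

theorem adjoint_frame_apply {ε : J → E} (hε : Orthonormal ℂ ε) (u : E) (j : J) :
    ContinuousLinearMap.adjoint (frame hε).toContinuousLinearMap u j = inner ℂ (ε j) u := by
  rw [← inner_delta, ContinuousLinearMap.adjoint_inner_right]
  change inner ℂ (frame hε (delta j)) u = _
  rw [frame_delta]

theorem adjoint_frame_frame {ε : J → E} (hε : Orthonormal ℂ ε)
    (ξ : Lp ℂ 2 (Measure.count : Measure J)) :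
    ContinuousLinearMap.adjoint (frame hε).toContinuousLinearMap (frame hε ξ) = ξ := by
  refine ext_inner_left ℂ fun y => ?_
  rw [ContinuousLinearMap.adjoint_inner_right]
  exact (frame hε).inner_map_map y ξ

/-- The operator `∑ c_j |ε'_j⟩⟨ε_j|`. -/
def sandwich {ε ε' : J → E} (hε' : Orthonormal ℂ ε') (c : J →ᵇ ℂ) (hε : Orthonormal ℂ ε) :
    E →L[ℂ] E :=
  (frame hε').toContinuousLinearMap ∘L mulRep Measure.count ℂ c ∘L
    ContinuousLinearMap.adjoint (frame hε).toContinuousLinearMap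

theorem hasSum_sandwich {ε ε' : J → E} (hε' : Orthonormal ℂ ε') (c : J →ᵇ ℂ)
    (hε : Orthonormal ℂ ε) (u : E) :
    HasSum (fun j => (inner ℂ (ε j) u * c j) • ε' j) (sandwich hε' c hε u) := by
  have h := (hasSum_delta (ContinuousLinearMap.adjoint (frame hε).toContinuousLinearMap u)).mapL
    ((frame hε').toContinuousLinearMap ∘L mulRep Measure.count ℂ c)
  refine h.congr_fun ?_
  intro j
  rw [map_smul, adjoint_frame_apply]
  change _ = _ • frame hε' (mulRep Measure.count ℂ c (delta j))
  rw [mulRep_count_delta, map_smul, frame_delta, smul_smul]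

/-- The frame of the middle family is an isometry, so it cancels against its adjoint. With
`star_sandwich` this reduces the identities of the swindle to multiplying coefficient functions. -/
theorem sandwich_mul_sandwich {ε ε' ε'' : J → E} (hε'' : Orthonormal ℂ ε'') (c : J →ᵇ ℂ)
    (hε' : Orthonormal ℂ ε') (c' : J →ᵇ ℂ) (hε : Orthonormal ℂ ε) :
    sandwich hε'' c hε' * sandwich hε' c' hε = sandwich hε'' (c * c') hε := by
  ext1 u
  change frame hε'' (mulRep _ ℂ c (ContinuousLinearMap.adjoint (frame hε').toContinuousLinearMap
    (frame hε' (mulRep _ ℂ c' _)))) = frame hε'' (mulRep _ ℂ (c * c') _)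
  rw [adjoint_frame_frame, map_mul]
  rfl

theorem star_sandwich {ε ε' : J → E} (hε' : Orthonormal ℂ ε') (c : J →ᵇ ℂ)
    (hε : Orthonormal ℂ ε) : star (sandwich hε' c hε) = sandwich hε (star c) hε' := by
  rw [sandwich, sandwich, ContinuousLinearMap.star_eq_adjoint, ContinuousLinearMap.adjoint_comp,
    ContinuousLinearMap.adjoint_comp, ContinuousLinearMap.adjoint_adjoint, map_star,
    ContinuousLinearMap.star_eq_adjoint, ContinuousLinearMap.comp_assoc]

end Discrete

end Roe

end

/-! ### Localized orthonormal families and membership in the Roe algebra. -/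

noncomputable section

/-- Continuous functions vanishing at infinity are uniform limits of functions vanishing off a
compact set. -/
theorem ZeroAtInftyContinuousMap.exists_approx {X : Type*} [TopologicalSpace X] (f : C₀(X, ℂ))
    {δ : ℝ} (hδ : 0 < δ) :
    ∃ g : C₀(X, ℂ), (∃ K : Set X, IsCompact K ∧ ∀ x ∉ K, g x = 0) ∧ ∀ x, ‖f x - g x‖ ≤ δ := by
  -- Soft thresholding: the modulus is lowered by `δ` and cut off at zero. The maximum in the
  -- denominator keeps the quotient continuous at `0`.
  let t : ℂ → ℂ := fun z => ((max 0 (‖z‖ - δ) / max ‖z‖ δ : ℝ) : ℂ) * z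
  have hm : ∀ z : ℂ, 0 < max ‖z‖ δ := fun z => lt_max_of_lt_right hδ
  have ht : Continuous t := by
    refine (Complex.continuous_ofReal.comp (Continuous.div ?_ ?_ fun z => (hm z).ne')).mul
      continuous_id
    · fun_prop
    · fun_prop
  have h0 : ∀ z, ‖z‖ ≤ δ → t z = 0 := fun z hz => by
    simp [t, max_eq_left (sub_nonpos.2 hz)]
  have hd : ∀ z, ‖z - t z‖ ≤ δ := fun z => by
    rcases le_total ‖z‖ δ with hz | hz
    · rwa [h0 z hz, sub_zero]
    · have hp : 0 < ‖z‖ := hδ.trans_le hz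
      have h1 : z - t z = ((δ / ‖z‖ : ℝ) : ℂ) * z := by
        simp only [t, max_eq_right (sub_nonneg.2 hz), max_eq_left hz]
        rw [sub_div, div_self hp.ne']
        push_cast
        ring
      rw [h1, norm_mul, Complex.norm_real, Real.norm_of_nonneg (by positivity),
        div_mul_cancel₀ _ hp.ne']
  have hev : ∀ᶠ x in Filter.cocompact X, ‖f x‖ < δ := by
    have h := Metric.tendsto_nhds.1 f.zero_at_infty' δ hδ
    simpa using h
  obtain ⟨K, hK, hKs⟩ := Filter.mem_cocompact.1 hev
  have hz : ∀ x ∉ K, t (f x) = 0 := fun x hx => h0 _ (hKs hx).le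
  refine ⟨⟨⟨fun x => t (f x), ht.comp f.continuous⟩, ?_⟩, ⟨K, hK, hz⟩, fun x => hd _⟩
  refine tendsto_const_nhds.congr' ?_
  filter_upwards [hK.compl_mem_cocompact] with x hx
  exact (hz x hx).symm

theorem InnerProductSpace.isCompactOperator_rankOne {E F : Type*} [NormedAddCommGroup E]
    [InnerProductSpace ℂ E] [NormedAddCommGroup F] [InnerProductSpace ℂ F] (x : E) (y : F) :
    IsCompactOperator (InnerProductSpace.rankOne ℂ x y) :=
  IsCompactOperator.clm_comp (M₂ := ℂ)
    (isCompactOperator_of_locallyCompactSpace_dom (innerSL ℂ y))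
    (ContinuousLinearMap.toSpanSingleton ℂ x)

namespace Roe

section Localized

variable {X : Type*} [MetricSpace X] [MeasurableSpace X] [BorelSpace X]
  {μ : Measure X} {H : Type*} [NormedAddCommGroup H] [InnerProductSpace ℂ H]

/-- The functions `ε j` vanish outside of the balls of radius `C` around the points `π j`. -/
def IsLocalized {J : Type*} (C : ℝ) (π : J → X) (ε : J → Lp H 2 μ) : Prop :=
  ∀ j, ∀ᵐ x ∂μ, C < dist x (π j) → ε j x = 0

variable [CompleteSpace H]

theorem act_apply_eq_zero {f : C₀(X, ℂ)} {ξ : Lp H 2 μ} {p : X} {C : ℝ}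
    (hξ : ∀ᵐ x ∂μ, C < dist x p → ξ x = 0) (hf : ∀ x, dist x p ≤ C → f x = 0) :
    act μ H f ξ = 0 := by
  refine Lp.ext ?_
  filter_upwards [coeFn_mulCLM μ H f.toBCF ξ, Lp.coeFn_zero H 2 μ, hξ] with x h1 h2 h3
  refine h1.trans ?_
  rw [h2]
  rcases le_or_gt (dist x p) C with h | h
  · have : f.toBCF x = 0 := hf x h
    simp [this]
  · simp [h3 h]

variable {J : Type*} [TopologicalSpace J] [DiscreteTopology J] [MeasurableSpace J]
  [OpensMeasurableSpace J]

/-- A function vanishing off a compact set kills all but finitely many `ε j`, so its product with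
the frame has finite rank; a general function is a uniform limit of such. The adjoint is carried
along because local compactness concerns multiplication on both sides. -/
theorem isCompactOperator_act_comp_frame {C : ℝ} {π : J → X} {ε : J → Lp H 2 μ}
    (hε : Orthonormal ℂ ε) (hl : IsLocalized C π ε)
    (hπ : ∀ s, Bornology.IsBounded s → (π ⁻¹' s).Finite) (f : C₀(X, ℂ)) :
    IsCompactOperator (act μ H f ∘L (frame hε).toContinuousLinearMap) ∧
      IsCompactOperator
        (ContinuousLinearMap.adjoint (act μ H f ∘L (frame hε).toContinuousLinearMap)) := by
  classical
  let S : Set (Lp ℂ 2 (Measure.count : Measure J) →L[ℂ] Lp H 2 μ) :=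
    {T | IsCompactOperator T} ∩ ContinuousLinearMap.adjoint ⁻¹' {T | IsCompactOperator T}
  have hS : IsClosed S := isClosed_setOfPred_isCompactOperator.inter
    (isClosed_setOfPred_isCompactOperator.preimage ContinuousLinearMap.adjoint.continuous)
  change act μ H f ∘L (frame hε).toContinuousLinearMap ∈ S
  rw [← hS.closure_eq]
  refine (Metric.mem_closure_iff
    (α := Lp ℂ 2 (Measure.count : Measure J) →L[ℂ] Lp H 2 μ)).2 fun δ hδ => ?_
  obtain ⟨g, ⟨K, hK, hgK⟩, hfg⟩ := f.exists_approx (half_pos hδ)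
  refine ⟨act μ H g ∘L (frame hε).toContinuousLinearMap, ?_, ?_⟩
  -- If the centre `π j` is farther than `C` from `K`, then `g` vanishes on the ball that carries `ε
  -- j`.
  · have hfin : (π ⁻¹' Metric.cthickening C K).Finite := hπ _ hK.isBounded.cthickening
    have hsum : act μ H g ∘L (frame hε).toContinuousLinearMap
        = ∑ j ∈ hfin.toFinset, InnerProductSpace.rankOne ℂ (act μ H g (ε j)) (delta j) := by
      refine eq_of_delta fun i => ?_
      have h1 : (act μ H g ∘L (frame hε).toContinuousLinearMap) (delta i) = act μ H g (ε i) :=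
        congrArg (act μ H g) (frame_delta hε i)
      rw [h1, sum_apply]
      simp only [InnerProductSpace.rankOne_apply, orthonormal_iff_ite.1 orthonormal_delta,
        ite_smul, one_smul, zero_smul, Finset.sum_ite_eq']
      split_ifs with hi
      · rfl
      · refine act_apply_eq_zero (hl i) fun x hx => hgK x fun hxK => hi ?_
        rw [Set.Finite.mem_toFinset]
        exact Metric.mem_cthickening_of_dist_le _ x _ _ hxK (by rwa [dist_comm])
    rw [hsum]
    constructor
    · exact (compactOperator (RingHom.id ℂ) _ _).sum_mem fun j _ =>
        InnerProductSpace.isCompactOperator_rankOne _ _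
    · rw [Set.mem_preimage, map_sum]
      exact (compactOperator (RingHom.id ℂ) _ _).sum_mem fun j _ => by
        rw [InnerProductSpace.adjoint_rankOne]
        exact InnerProductSpace.isCompactOperator_rankOne _ _
  · refine (dist_eq_norm (act μ H f ∘L (frame hε).toContinuousLinearMap)
      (act μ H g ∘L (frame hε).toContinuousLinearMap)).trans_lt ?_
    rw [← ContinuousLinearMap.sub_comp, ← map_sub]
    refine lt_of_le_of_lt ?_ (half_lt_self hδ)
    refine (ContinuousLinearMap.opNorm_comp_le _ _).trans ?_
    refine (mul_le_of_le_one_right (norm_nonneg _)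
      (LinearIsometry.norm_toContinuousLinearMap_le _)).trans
        ((norm_mulCLM_le μ H (f - g).toBCF).trans ?_)
    rw [BoundedContinuousFunction.norm_le (half_pos hδ).le]
    exact hfg

/-- Each term moves mass from the `C`-ball at `π j` to the `C`-ball at `π' j`, hence over a distance
at most `C + R + C`. Local compactness comes from the two compact products of the frames with
functions. -/
theorem sandwich_mem_roeSubalgebra {C R : ℝ} {π π' : J → X} {ε ε' : J → Lp H 2 μ}
    {hε : Orthonormal ℂ ε} (hl : IsLocalized C π ε)
    (hπ : ∀ s, Bornology.IsBounded s → (π ⁻¹' s).Finite)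
    {hε' : Orthonormal ℂ ε'} (hl' : IsLocalized C π' ε')
    (hπ' : ∀ s, Bornology.IsBounded s → (π' ⁻¹' s).Finite)
    (hR : ∀ j, dist (π' j) (π j) ≤ R) (c : J →ᵇ ℂ) :
    sandwich hε' c hε ∈ roeSubalgebra (act μ H) := by
  refine mem_roeSubalgebra _ (fun f => ⟨?_, ?_⟩)
    ⟨max (C + R + C) 1, lt_max_of_lt_right one_pos, fun f g hfg => ?_⟩
  · have h := (isCompactOperator_act_comp_frame hε hl hπ (star f)).2
    rw [ContinuousLinearMap.adjoint_comp, star_act] at h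
    exact h.clm_comp ((frame hε').toContinuousLinearMap ∘L mulRep Measure.count ℂ c)
  · have h := (isCompactOperator_act_comp_frame hε' hl' hπ' f).1
    exact h.comp_clm (mulRep Measure.count ℂ c ∘L
      ContinuousLinearMap.adjoint (frame hε).toContinuousLinearMap)
  · ext1 u
    have h := (hasSum_sandwich hε' c hε (act μ H g u)).mapL (act μ H f)
    refine h.unique ?_
    refine hasSum_zero.congr_fun fun j => ?_
    rw [map_smul]
    -- Every term dies: if `g` is nonzero somewhere on the ball at `π j`, then `f` is too far away
    -- to meet the ball at `π' j`; otherwise the coefficient `⟨ε j, g u⟩` is zero.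
    by_cases hg : ∃ y, dist y (π j) ≤ C ∧ g y ≠ 0
    · obtain ⟨y, hy, hgy⟩ := hg
      have : act μ H f (ε' j) = 0 := by
        refine act_apply_eq_zero (hl' j) fun x hx => ?_
        by_contra hfx
        have h1 := hfg x (subset_tsupport _ hfx) y (subset_tsupport _ hgy)
        have h2 := dist_triangle4 x (π' j) (π j) y
        have h3 := hR j
        rw [dist_comm (π j) y] at h2
        have h4 := (le_max_left (C + R + C) 1).trans_lt h1
        linarith
      simp [this]
    · push Not at hg
      have h1 : act μ H (star g) (ε j) = 0 :=
        act_apply_eq_zero (hl j) fun x hx => by simp [hg x hx]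
      have h2 : inner ℂ (ε j) (act μ H g u) = 0 := by
        rw [← star_act, ContinuousLinearMap.adjoint_inner_right, h1, inner_zero_left]
      simp [h2]

end Localized

end Roe

end

noncomputable section

namespace Roe

/-! ### The shift along the rays, and finiteness of bounded sets. -/

section Shift

/-- A ray structure gives an injective map of bounded displacement (the shift along the rays)
which increases the depth of every point (its position on its ray) by one. -/
theorem HasRayStructure.exists_shift {D : Type*} [MetricSpace D] (h : HasRayStructure D) :
    ∃ (σ : D → D) (N : D → ℕ) (C : ℝ), Function.Injective σ ∧ (∀ y, N (σ y) = N y + 1) ∧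
      ∀ y, dist (σ y) y ≤ C := by
  obtain ⟨I, S, β, C, hdisj, hcov, hβ⟩ := h
  have hmem : ∀ i n, β i n ∈ S i := fun i n => (hβ i).1.mapsTo trivial
  have hex : ∀ y, ∃ i n, β i n = y := fun y => by
    have hy : y ∈ ⋃ i, S i := hcov ▸ Set.mem_univ y
    obtain ⟨i, hi⟩ := Set.mem_iUnion.1 hy
    obtain ⟨n, -, hn⟩ := (hβ i).1.surjOn hi
    exact ⟨i, n, hn⟩
  choose r N hrN using hex
  -- A point determines its ray and its position there: the rays are disjoint and each
  -- parametrization is injective.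
  have hinj : ∀ i j m n, β i m = β j n → i = j ∧ m = n := fun i j m n hij => by
    have h1 : i = j := by
      by_contra hne
      exact Set.disjoint_left.1 (hdisj hne) (hmem i m) (hij ▸ hmem j n)
    subst h1
    exact ⟨rfl, (hβ i).1.injOn trivial trivial hij⟩
  refine ⟨fun y => β (r y) (N y + 1), N, C, fun x y hxy => ?_, fun y => ?_, fun y => ?_⟩
  · obtain ⟨h1, h2⟩ := hinj _ _ _ _ hxy
    rw [← hrN x, ← hrN y, h1, Nat.add_right_cancel h2]
  · exact (hinj _ _ _ _ (hrN (β (r y) (N y + 1)))).2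
  · conv_lhs => rw [← hrN y]
    rw [hrN y]
    have h1 := (hβ (r y)).2.dist_le_mul (N y + 1) (N y)
    rw [hrN y] at h1
    exact h1.trans_eq (by simp [Nat.dist_eq])

theorem BoundedGeometry.finite_preimage {D X : Type*} [MetricSpace D] [MetricSpace X]
    (hB : BoundedGeometry D) {ι : D → X} (hι : Isometry ι) {s : Set X}
    (hs : Bornology.IsBounded s) : (ι ⁻¹' s).Finite := by
  rcases (ι ⁻¹' s).eq_empty_or_nonempty with h | ⟨x, hx⟩
  · rw [h]
    exact Set.finite_empty
  · obtain ⟨R, hR0, hR⟩ := hs.subset_closedBall_lt 0 (ι x)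
    obtain ⟨n, hn⟩ := hB R hR0
    have hfin : (Metric.closedBall x R).Finite :=
      Set.finite_of_encard_le_coe (hn x)
    refine hfin.subset fun y hy => ?_
    have := hR hy
    rwa [Metric.mem_closedBall, hι.dist_eq] at this

end Shift

/-! ### Orthogonal sums of diagonal operators. -/

section Sums

variable {E : Type*} [NormedAddCommGroup E] [InnerProductSpace ℂ E] [CompleteSpace E]

/-- Pullback of bounded functions along a continuous map. -/
def pullback {Y Z : Type*} [TopologicalSpace Y] [TopologicalSpace Z] (p : C(Y, Z)) :
    (Z →ᵇ ℂ) →⋆ₙₐ[ℂ] (Y →ᵇ ℂ) where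
  toFun c := c.compContinuous p
  map_smul' _ _ := rfl
  map_zero' := rfl
  map_add' _ _ := rfl
  map_mul' _ _ := rfl
  map_star' _ := rfl

theorem sandwich_mul_sandwich_of_orthogonal {I J : Type*}
    [TopologicalSpace I] [DiscreteTopology I] [MeasurableSpace I] [OpensMeasurableSpace I]
    [TopologicalSpace J] [DiscreteTopology J] [MeasurableSpace J] [OpensMeasurableSpace J]
    {ε : I → E} (hε : Orthonormal ℂ ε) {η : J → E} (hη : Orthonormal ℂ η)
    (h : ∀ i j, inner ℂ (ε i) (η j) = 0) (c : I →ᵇ ℂ) (d : J →ᵇ ℂ) :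
    sandwich hε c hε * sandwich hη d hη = 0 := by
  have h0 : ContinuousLinearMap.adjoint (frame hε).toContinuousLinearMap ∘L
      (frame hη).toContinuousLinearMap = 0 := by
    refine eq_of_delta fun j => Lp.ext (ae_count_iff.2 fun i => ?_)
    have h1 : (ContinuousLinearMap.adjoint (frame hε).toContinuousLinearMap ∘L
        (frame hη).toContinuousLinearMap) (delta j) i = inner ℂ (ε i) (frame hη (delta j)) :=
      adjoint_frame_apply hε _ i
    rw [h1, frame_delta, h, zero_apply, ae_count_iff.1 (Lp.coeFn_zero ℂ 2 _) i]
    rfl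
  ext1 u
  have h1 := DFunLike.congr_fun h0 (mulRep Measure.count ℂ d
    (ContinuousLinearMap.adjoint (frame hη).toContinuousLinearMap u))
  have h2 := congrArg (fun w => frame hε (mulRep Measure.count ℂ c w)) h1
  refine h2.trans ?_
  simp

variable {D : Type*} [TopologicalSpace D] [DiscreteTopology D] [MeasurableSpace D]
  [OpensMeasurableSpace D]

/-- The series over `D × ℕ` is split into the terms with second index `0` and those with a
successor; this is the decomposition `f = f₀ + f₁` of the swindle. -/
theorem sandwich_prod_nat {ε : D × ℕ → E} (hε : Orthonormal ℂ ε)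
    (h0 : Orthonormal ℂ fun y => ε (y, 0)) (h1 : Orthonormal ℂ fun j : D × ℕ => ε (j.1, j.2 + 1))
    (c : D →ᵇ ℂ) :
    sandwich hε (pullback ⟨Prod.fst, continuous_fst⟩ c) hε
      = sandwich h0 c h0 + sandwich h1 (pullback ⟨Prod.fst, continuous_fst⟩ c) h1 := by
  ext1 u
  have s := hasSum_sandwich hε (pullback ⟨Prod.fst, continuous_fst⟩ c) hε u
  have s0 := hasSum_sandwich h0 c h0 u
  have s1 := hasSum_sandwich h1 (pullback ⟨Prod.fst, continuous_fst⟩ c) h1 u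
  let F : D × ℕ → E := fun j => (inner ℂ (ε j) u * c j.1) • ε j
  have t0 : HasSum (fun j : D × ℕ => if j.2 = 0 then F j else 0) (sandwich h0 c h0 u) := by
    refine (Function.Injective.hasSum_iff (g := fun y : D => (y, 0))
      (fun x y hxy => congrArg Prod.fst hxy) ?_).1 ?_
    · rintro ⟨y, k⟩ hk
      rw [if_neg]
      rintro rfl
      exact hk ⟨y, rfl⟩
    · simpa [Function.comp_def, F] using s0
  have t1 : HasSum (fun j : D × ℕ => if j.2 = 0 then 0 else F j)
      (sandwich h1 (pullback ⟨Prod.fst, continuous_fst⟩ c) h1 u) := by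
    refine (Function.Injective.hasSum_iff (g := fun j : D × ℕ => (j.1, j.2 + 1))
      (fun x y hxy => ?_) ?_).1 ?_
    · simp only [Prod.mk.injEq, Nat.add_right_cancel_iff] at hxy
      exact Prod.ext hxy.1 hxy.2
    · rintro ⟨y, _ | k⟩ hk
      · rfl
      · exact absurd ⟨(y, k), rfl⟩ hk
    · exact s1
  refine s.unique ((t0.add t1).congr_fun fun j => ?_)
  by_cases hj : j.2 = 0
  · simp only [hj, if_true, add_zero]; rfl
  · simp only [hj, if_false, zero_add]; rfl

end Sums

/-! ### The swindle along the rays. -/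

section Swindle

variable {D : Type*} [MetricSpace D] [DiscreteTopology D] [MeasurableSpace D]
  [OpensMeasurableSpace D]
  {X : Type*} [MetricSpace X] [MeasurableSpace X] [BorelSpace X]
  {μ : Measure X} {H : Type*} [NormedAddCommGroup H] [InnerProductSpace ℂ H] [CompleteSpace H]

/-- The Eilenberg swindle along the rays of `D`: moving mass to infinity along the rays kills the
diagonal operators with respect to an orthonormal family localized at the points of `D`, provided
that it extends to an orthonormal family with infinitely many members at each point. -/
theorem exists_hom_map_eq_zero (hB : BoundedGeometry D) (hR : HasRayStructure D) {ι : D → X}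
    (hι : Isometry ι) {C : ℝ} {e : D × ℕ → Lp H 2 μ} (he : Orthonormal ℂ e)
    (hl : IsLocalized C (fun j => ι j.1) e) (he₀ : Orthonormal ℂ fun y => e (y, 0)) :
    ∃ f₀ : (D →ᵇ ℂ) →⋆ₙₐ[ℂ] RoeAlgebra μ H,
      (∀ c, RoeAlg.op _ (f₀ c) = sandwich he₀ c he₀) ∧
      ∀ z : OperatorK.K0 (D →ᵇ ℂ), OperatorK.K0.map f₀ z = 0 := by
  obtain ⟨σ, N, R, hσ, hN, hd⟩ := hR.exists_shift
  have hNk : ∀ k y, N (σ^[k] y) = N y + k := fun k => by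
    induction k with
    | zero => exact fun y => rfl
    | succ k ih =>
      intro y
      rw [Function.iterate_succ_apply', hN, ih, add_assoc]
  -- The second coordinate is retained so that `s` is injective, although different rounds of the
  -- shift hit the same point of `D`.
  let s : D × ℕ → D × ℕ := fun j => (σ^[j.2] j.1, j.2)
  have hs : Function.Injective s := by
    rintro ⟨x, k⟩ ⟨y, l⟩ hxy
    simp only [s, Prod.mk.injEq] at hxy
    obtain ⟨h1, rfl⟩ := hxy
    rw [hσ.iterate k h1]
  let t : D × ℕ → D × ℕ := fun j => (j.1, j.2 + 1)
  have ht : Function.Injective t := fun x y hxy => by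
    simp only [t, Prod.mk.injEq, Nat.add_right_cancel_iff] at hxy
    exact Prod.ext hxy.1 hxy.2
  let π : D × ℕ → X := fun j => ι (s j).1
  -- The depth of `σ^k y` is `N y + k`, so a point `x` is reached only with `k ≤ N x`; bounded
  -- geometry leaves finitely many `x` in `b`.
  have hfin : ∀ b, Bornology.IsBounded b → (π ⁻¹' b).Finite := fun b hb => by
    have h1 := hB.finite_preimage hι hb
    have h2 : (⋃ x ∈ ι ⁻¹' b, ({x} : Set D) ×ˢ Set.Iic (N x)).Finite :=
      h1.biUnion fun x _ => (Set.finite_singleton x).prod (Set.finite_Iic _)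
    refine (h2.preimage hs.injOn).subset fun j hj => ?_
    rw [Set.mem_preimage, Set.mem_iUnion₂]
    refine ⟨(s j).1, hj, rfl, ?_⟩
    change j.2 ≤ N (σ^[j.2] j.1)
    rw [hNk]
    exact Nat.le_add_left _ _
  have hfin₁ : ∀ b, Bornology.IsBounded b → ((fun j => π (t j)) ⁻¹' b).Finite := fun b hb =>
    Set.Finite.preimage (f := t) ht.injOn (hfin b hb)
  let ε : D × ℕ → Lp H 2 μ := fun j => e (s j)
  have hε : Orthonormal ℂ ε := he.comp s hs
  have hε₁ : Orthonormal ℂ fun j => ε (t j) := hε.comp t ht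
  have hlε : IsLocalized C π ε := fun j => hl (s j)
  have hlε₁ : IsLocalized C (fun j => π (t j)) fun j => ε (t j) := fun j => hlε (t j)
  have hl₀ : IsLocalized C ι fun y => e (y, 0) := fun y => hl (y, 0)
  let p : (D →ᵇ ℂ) →⋆ₙₐ[ℂ] (D × ℕ →ᵇ ℂ) := pullback ⟨Prod.fst, continuous_fst⟩
  have hp1 : p 1 = 1 := rfl
  let f : (D →ᵇ ℂ) →⋆ₙₐ[ℂ] RoeAlgebra μ H := RoeAlg.lift
    ((conjIsometry (frame hε)).comp ((mulRep Measure.count ℂ).comp p))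
    fun c => sandwich_mem_roeSubalgebra (R := 0) (hε := hε) (hε' := hε) hlε hfin hlε hfin
      (fun j => (dist_self _).le) (p c)
  let f₁ : (D →ᵇ ℂ) →⋆ₙₐ[ℂ] RoeAlgebra μ H := RoeAlg.lift
    ((conjIsometry (frame hε₁)).comp ((mulRep Measure.count ℂ).comp p))
    fun c => sandwich_mem_roeSubalgebra (R := 0) (hε := hε₁) (hε' := hε₁) hlε₁ hfin₁ hlε₁ hfin₁
      (fun j => (dist_self _).le) (p c)
  let f₀ : (D →ᵇ ℂ) →⋆ₙₐ[ℂ] RoeAlgebra μ H := RoeAlg.lift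
    ((conjIsometry (frame he₀)).comp (mulRep Measure.count ℂ))
    fun c => sandwich_mem_roeSubalgebra (R := 0) (hε := he₀) (hε' := he₀) hl₀
      (fun b hb => hB.finite_preimage hι hb) hl₀ (fun b hb => hB.finite_preimage hι hb)
      (fun j => (dist_self _).le) c
  have hf : ∀ c, RoeAlg.op _ (f c) = sandwich hε (p c) hε := fun c => rfl
  have hf₁ : ∀ c, RoeAlg.op _ (f₁ c) = sandwich hε₁ (p c) hε₁ := fun c => rfl
  have hf₀ : ∀ c, RoeAlg.op _ (f₀ c) = sandwich he₀ c he₀ := fun c => rfl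
  -- The operator `ε (y, k) ↦ ε (y, k + 1)`. Its centres move from `σ^k y` to `σ^(k+1) y`, a single
  -- step of length at most `R`.
  let v : RoeAlgebra μ H := RoeAlg.mk (sandwich hε₁ 1 hε)
    (sandwich_mem_roeSubalgebra (R := R) hlε hfin hlε₁ hfin₁ (fun j => by
      change dist (ι (σ^[j.2 + 1] j.1)) (ι (σ^[j.2] j.1)) ≤ R
      rw [hι.dist_eq, Function.iterate_succ_apply']
      exact hd _) 1)
  have hv : RoeAlg.op _ v = sandwich hε₁ 1 hε := rfl
  refine ⟨f₀, hf₀, OperatorK.K0.map_eq_zero_of_swindle 1 one_mul mul_one (star_one _)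
    (f := f) (f₁ := f₁) (fun c => RoeAlg.op_injective ?_) (fun c d => RoeAlg.op_injective ?_) v
    (fun c => RoeAlg.op_injective ?_) (fun c => RoeAlg.op_injective ?_)⟩
  · rw [map_add, hf, hf₁, hf₀]
    exact sandwich_prod_nat hε he₀ hε₁ c
  · rw [map_mul, map_zero, hf₁, hf₀]
    refine sandwich_mul_sandwich_of_orthogonal he₀ hε₁ (fun y j => ?_) c (p d)
    refine he.2 fun h => ?_
    exact absurd (congrArg Prod.snd h) (Nat.succ_ne_zero _).symm
  · rw [map_mul, map_mul, map_star, hf, hf₁, hv, star_sandwich, sandwich_mul_sandwich,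
      sandwich_mul_sandwich, star_one, one_mul, mul_one]
  · rw [map_mul, map_mul, map_star, hf, hv, star_sandwich, sandwich_mul_sandwich,
      sandwich_mul_sandwich, star_one, one_mul, one_mul]

end Swindle

end Roe

end

noncomputable section

set_option linter.unusedSectionVars false

namespace Roe

/-! ### Part (1): the stabilized diagonal. -/

section DiscreteCase

variable {D : Type*} [MetricSpace D] [DiscreteTopology D] [MeasurableSpace D] [BorelSpace D]
  {H : Type*} [NormedAddCommGroup H] [InnerProductSpace ℂ H]

/-- The vector `δ_y ⊗ h ∈ ℓ²(D) ⊗ H`. -/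
def deltaTensor (y : D) (h : H) : Lp H 2 (Measure.count : Measure D) :=
  indicatorConstLp 2 (isOpen_discrete {y}).measurableSet (count_singleton_ne_top y) h

theorem deltaTensor_apply [DecidableEq D] (y : D) (h : H) (x : D) :
    deltaTensor y h x = if x = y then h else 0 := by
  refine (ae_count_iff.1 (indicatorConstLp_coeFn (p := 2)
    (hs := (isOpen_discrete {y}).measurableSet) (hμs := count_singleton_ne_top y) (c := h))
    x).trans ?_
  simp [Set.indicator_apply]

variable [CompleteSpace H]

theorem orthonormal_deltaTensor {h : ℕ → H} (hh : Orthonormal ℂ h) :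
    Orthonormal ℂ fun j : D × ℕ => deltaTensor j.1 (h j.2) := by
  classical
  rw [orthonormal_iff_ite]
  rintro ⟨x, k⟩ ⟨y, l⟩
  rw [deltaTensor, deltaTensor, L2.inner_indicatorConstLp_indicatorConstLp _ _
    (count_singleton_ne_top x) (count_singleton_ne_top y), orthonormal_iff_ite.1 hh]
  by_cases hxy : x = y
  · subst hxy
    simp [Measure.real]
  · have : ({x} ∩ {y} : Set D) = ∅ := Set.singleton_inter_eq_empty.2 hxy
    simp [this, hxy]

theorem ampl_delta (V : ℂ →ₗᵢ[ℂ] H) (y : D) :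
    ampl Measure.count V (delta y) = deltaTensor y (V 1) := by
  classical
  refine Lp.ext (ae_count_iff.2 fun x => ?_)
  refine (ae_count_iff.1 (V.toContinuousLinearMap.coeFn_compLpL (p := 2) (μ := Measure.count)
    (delta y)) x).trans ?_
  rw [deltaTensor_apply]
  change V (delta y x) = _
  rw [delta_apply]
  by_cases h : x = y
  · simp [h]
  · simp [h, Ne.symm h]

theorem diagonal_one (hD : UniformlyDiscrete D) : diagonal hD 1 = unit hD := by
  refine RoeAlg.op_injective ?_
  change mulRep Measure.count ℂ 1 = 1
  refine eq_of_delta fun j => ?_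
  rw [mulRep_count_delta]
  simp

theorem iStar_gamma_eq_zero (hD : UniformlyDiscrete D) (hB : BoundedGeometry D)
    (hR : HasRayStructure D) (hH : ¬ FiniteDimensional ℂ H) (V : ℂ →ₗᵢ[ℂ] H)
    (z : OperatorK.K0 (D →ᵇ ℂ)) : iStar Measure.count V (gamma hD z) = 0 := by
  classical
  obtain ⟨h, hh, h0⟩ := exists_orthonormal_nat_extending hH (V 1) (by simp)
  have he := orthonormal_deltaTensor (D := D) hh
  have hl : IsLocalized 0 (fun j : D × ℕ => id j.1) fun j => deltaTensor j.1 (h j.2) :=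
    fun j => ae_count_iff.2 fun x hx => by
      rw [deltaTensor_apply, if_neg (show x ≠ j.1 from dist_pos.1 hx)]
  have he₀ : Orthonormal ℂ fun y : D => deltaTensor y (h 0) :=
    he.comp (fun y => (y, 0)) fun x y hxy => congrArg Prod.fst hxy
  obtain ⟨f₀, hf₀, hz⟩ := exists_hom_map_eq_zero hB hR isometry_id he hl he₀
  -- Since `h 0 = V 1`, the amplification sends `δ_y` to the vector with label `0` at `y`; hence
  -- stabilizing the diagonal gives exactly `f₀`.
  have hframe : (ampl Measure.count V).toContinuousLinearMap
      = (frame he₀).toContinuousLinearMap := by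
    refine eq_of_delta fun y => (ampl_delta V y).trans ?_
    rw [← h0]
    exact (frame_delta he₀ y).symm
  have hf : (stabilize Measure.count V).comp (diagonal hD) = f₀ := by
    refine NonUnitalStarAlgHom.ext fun c => RoeAlg.op_injective ?_
    rw [hf₀, sandwich, ← hframe]
    rfl
  rw [iStar, gamma, OperatorK.K0.map_map, hf, hz]

theorem unit_mem_range_gamma (hD : UniformlyDiscrete D) :
    OperatorK.K0.ofProj (unit hD) (isStarProjection_unit hD) ∈ (gamma hD).range :=
  ⟨OperatorK.K0.ofProj 1 ⟨one_mul _, star_one _⟩,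
    OperatorK.K0.map_ofProj _ _ _ _ _ (diagonal_one hD)⟩

end DiscreteCase

/-! ### Part (2): Wannier projections. -/

section Wannier

variable {X : Type*} [MetricSpace X] [MeasurableSpace X] [BorelSpace X] {μ : Measure X}

/-- Off the support, vanishing almost everywhere holds near each point; second countability turns
this local nullity into a global one. -/
theorem ae_eq_zero_of_notMem_supp [SecondCountableTopology X] (φ : Lp ℂ 2 μ) :
    ∀ᵐ y ∂μ, y ∉ supp φ → φ y = 0 := by
  rw [ae_iff]
  refine measure_null_of_locally_null _ fun x hx => ?_
  simp only [Set.mem_ofPred_eq, Classical.not_imp] at hx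
  obtain ⟨hx, -⟩ := hx
  simp only [supp, Set.mem_ofPred_eq, not_forall, not_not] at hx
  obtain ⟨U, hU, hxU, h⟩ := hx
  refine ⟨U ∩ {y | ¬(y ∉ supp φ → φ y = 0)},
    Filter.inter_mem (mem_nhdsWithin_of_mem_nhds (hU.mem_nhds hxU)) self_mem_nhdsWithin, ?_⟩
  refine measure_mono_null ?_ (ae_iff.1 h)
  rintro y ⟨hyU, hy⟩ h0
  exact hy fun _ => h0 hyU

/-- A finite support would be a null set, forcing `φ = 0`. This is where the absence of atoms
enters. -/
theorem infinite_supp [SecondCountableTopology X] [NullSingletonClass μ] {φ : Lp ℂ 2 μ}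
    (hφ : φ ≠ 0) : (supp φ).Infinite := by
  intro hfin
  refine hφ (Lp.ext ?_)
  filter_upwards [ae_eq_zero_of_notMem_supp φ, Lp.coeFn_zero ℂ 2 μ,
    measure_eq_zero_iff_ae_notMem.1 (hfin.measure_zero μ)] with y h1 h2 h3
  rw [h2, h1 h3]
  rfl

/-- The `L²` functions which vanish almost everywhere on the zero set of `φ`. -/
def cutSubmodule (φ : Lp ℂ 2 μ) : Submodule ℂ (Lp ℂ 2 μ) where
  carrier := {ξ | ∀ᵐ y ∂μ, φ y = 0 → ξ y = 0}
  add_mem' {ξ η} hξ hη := by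
    filter_upwards [hξ, hη, Lp.coeFn_add ξ η] with y h1 h2 h3 h
    rw [h3, Pi.add_apply, h1 h, h2 h, add_zero]
  zero_mem' := by
    filter_upwards [Lp.coeFn_zero ℂ 2 μ] with y h1 _
    rw [h1]
    rfl
  smul_mem' c ξ hξ := by
    filter_upwards [hξ, Lp.coeFn_smul c ξ] with y h1 h2 h
    rw [h2, Pi.smul_apply, h1 h, smul_zero]

theorem not_finiteDimensional_cutSubmodule {φ : Lp ℂ 2 μ} (hφ : (supp φ).Infinite) :
    ¬ FiniteDimensional ℂ (cutSubmodule φ) := by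
  classical
  intro hfd
  obtain ⟨s, hs, hcard⟩ := hφ.exists_subset_card_eq (Module.finrank ℂ (cutSubmodule φ) + 1)
  obtain ⟨U, hU, hdisj⟩ := s.finite_toSet.t2_separation
  -- Cutting `φ` to disjoint neighbourhoods of `finrank + 1` points of its support gives as many
  -- pairwise orthogonal vectors, each nonzero by the definition of the support.
  let w : s → Lp ℂ 2 μ := fun x =>
    ((Lp.memLp φ).indicator (hU x).2.measurableSet).toLp _
  have hw : ∀ x : s, ∀ᵐ y ∂μ, w x y = (U x).indicator φ y := fun x => MemLp.coeFn_toLp _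
  have hwmem : ∀ x, w x ∈ cutSubmodule φ := fun x => by
    filter_upwards [hw x] with y h1 h2
    rw [h1, Set.indicator_apply, h2, ite_self]
  have hw0 : ∀ x, w x ≠ 0 := fun x h0 => by
    refine hs x.2 (U x) (hU x).2 (hU x).1 ?_
    have h2 : ∀ᵐ y ∂μ, w x y = (0 : X → ℂ) y := by
      rw [h0]
      exact Lp.coeFn_zero ℂ 2 μ
    filter_upwards [hw x, h2] with y h1 h2 hy
    rw [h2, Set.indicator_of_mem hy] at h1
    exact h1.symm
  have horth : ∀ x x', x ≠ x' → inner ℂ (w x) (w x') = 0 := fun x x' hne => by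
    rw [L2.inner_def]
    refine integral_eq_zero_of_ae ?_
    filter_upwards [hw x, hw x'] with y h1 h2
    rw [h1, h2]
    by_cases hy : y ∈ U x
    · have hy' : y ∉ U x' := Set.disjoint_left.1
        (hdisj x.2 x'.2 fun h => hne (Subtype.ext h)) hy
      simp [hy']
    · simp [hy]
  have hli : LinearIndependent ℂ fun x => (⟨w x, hwmem x⟩ : cutSubmodule φ) :=
    linearIndependent_of_ne_zero_of_inner_eq_zero
      (fun x h => hw0 x (congrArg Subtype.val h)) (fun x x' hne => horth x x' hne)
  have := hli.fintype_card_le_finrank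
  rw [Fintype.card_coe, hcard] at this
  omega

theorem inner_eq_zero_of_mem_cutSubmodule {φ φ' ξ ξ' : Lp ℂ 2 μ}
    (h : ∀ᵐ y ∂μ, φ y = 0 ∨ φ' y = 0) (hξ : ξ ∈ cutSubmodule φ) (hξ' : ξ' ∈ cutSubmodule φ') :
    inner ℂ ξ ξ' = 0 := by
  rw [L2.inner_def]
  refine integral_eq_zero_of_ae ?_
  filter_upwards [h, hξ, hξ'] with y h1 h2 h3
  rcases h1 with h1 | h1
  · simp [h2 h1]
  · simp [h3 h1]

/-- With coefficient `1` the sandwich is `W W*` for the frame `W`. Its values are limits of elements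
of the span, and `u - W W* u` is orthogonal to every `ε j`. -/
theorem starProjection_span_eq_sandwich {J E : Type*} [TopologicalSpace J] [DiscreteTopology J]
    [MeasurableSpace J] [OpensMeasurableSpace J] [NormedAddCommGroup E] [InnerProductSpace ℂ E]
    [CompleteSpace E] {ε : J → E} (hε : Orthonormal ℂ ε) :
    (Submodule.span ℂ (Set.range ε)).topologicalClosure.starProjection = sandwich hε 1 hε := by
  ext1 u
  refine Submodule.eq_starProjection_of_mem_orthogonal ?_ ?_
  · refine (Submodule.isClosed_topologicalClosure _).mem_of_tendsto (hasSum_sandwich hε 1 hε u)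
      (Filter.Eventually.of_forall fun s => ?_)
    exact Submodule.sum_mem _ fun j _ => Submodule.smul_mem _ _
      (Submodule.le_topologicalClosure _ (Submodule.subset_span ⟨j, rfl⟩))
  · rw [Submodule.orthogonal_closure]
    suffices hle : Submodule.span ℂ (Set.range ε) ≤ (ℂ ∙ (u - sandwich hε 1 hε u))ᗮ from
      fun w hw => Submodule.mem_orthogonal_singleton_iff_inner_left.1 (hle hw)
    rw [Submodule.span_le]
    rintro _ ⟨j, rfl⟩
    rw [SetLike.mem_coe, Submodule.mem_orthogonal_singleton_iff_inner_left, inner_sub_right,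
      sub_eq_zero]
    have h : sandwich hε 1 hε u
        = frame hε (ContinuousLinearMap.adjoint (frame hε).toContinuousLinearMap u) := by
      have h1 : mulRep Measure.count ℂ (1 : J →ᵇ ℂ) = 1 := eq_of_delta fun j => by
        rw [mulRep_count_delta]
        simp
      rw [sandwich, h1]
      rfl
    conv_rhs => rw [h, ← frame_delta hε j, LinearIsometry.inner_map_map, inner_delta,
      adjoint_frame_apply]

theorem IsWannierBasis.exists_proj {D : Type*} [MetricSpace D] [MeasurableSpace D] [BorelSpace D]
    (hD : UniformlyDiscrete D) (hB : BoundedGeometry D) (hR : HasRayStructure D)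
    [SecondCountableTopology X] [NullSingletonClass μ] {ι : D → X} (hι : Isometry ι)
    {φ : D → Lp ℂ 2 μ} (hφ : IsWannierBasis ι φ) :
    ∃ (p : RoeAlgebra μ ℂ) (hp : IsStarProjection p),
      RoeAlg.op _ p = wannierProj φ ∧ OperatorK.K0.ofProj p hp = 0 := by
  have := hD.discreteTopology
  obtain ⟨hdisj, hmem, ⟨C, hC⟩, hnorm⟩ := hφ
  have hself : ∀ x, φ x ∈ cutSubmodule (φ x) := fun x =>
    show ∀ᵐ y ∂μ, φ x y = 0 → φ x y = 0 from Filter.Eventually.of_forall fun y h => h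
  -- The additional vectors are taken inside `cutSubmodule (φ x)`, so they inherit from `φ x` both
  -- the localization near `ι x` and the orthogonality to vectors attached to other points.
  have hex : ∀ x, ∃ e : ℕ → cutSubmodule (φ x), Orthonormal ℂ e ∧ e 0 = ⟨φ x, hself x⟩ := fun x =>
    exists_orthonormal_nat_extending
      (not_finiteDimensional_cutSubmodule (infinite_supp fun h => by simpa [h] using hnorm x)) _
      (hnorm x)
  choose a ha ha0 using hex
  let e : D × ℕ → Lp ℂ 2 μ := fun j => a j.1 j.2
  have hzero : ∀ x x', x ≠ x' → ∀ᵐ y ∂μ, φ x y = 0 ∨ φ x' y = 0 := fun x x' hne => by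
    filter_upwards [ae_eq_zero_of_notMem_supp (φ x), ae_eq_zero_of_notMem_supp (φ x')] with y h1 h2
    by_cases hy : y ∈ supp (φ x)
    · exact Or.inr (h2 (Set.disjoint_left.1 (hdisj x x' hne) hy))
    · exact Or.inl (h1 hy)
  have he : Orthonormal ℂ e := by
    refine ⟨fun j => (ha j.1).1 j.2, ?_⟩
    rintro ⟨x, k⟩ ⟨x', k'⟩ hne
    by_cases hx : x = x'
    · subst hx
      exact (ha x).2 fun h => hne (Prod.ext rfl h)
    · exact inner_eq_zero_of_mem_cutSubmodule (hzero x x' hx) (a x k).2 (a x' k').2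
  have hl : IsLocalized C (fun j : D × ℕ => ι j.1) e := fun j => by
    filter_upwards [(a j.1 j.2).2, ae_eq_zero_of_notMem_supp (φ j.1)] with y h1 h2 hy
    exact h1 (h2 fun h => hy.not_ge (hC j.1 y h _ (hmem j.1)))
  have he₀ : Orthonormal ℂ fun y => e (y, 0) :=
    he.comp (fun y => (y, 0)) fun x y hxy => congrArg Prod.fst hxy
  obtain ⟨f₀, hf₀, hz⟩ := exists_hom_map_eq_zero hB hR hι he hl he₀
  have hone : IsStarProjection (1 : D →ᵇ ℂ) := ⟨one_mul _, star_one _⟩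
  have hp : IsStarProjection (f₀ 1) := ⟨by rw [IsIdempotentElem, ← map_mul, one_mul],
    by rw [IsSelfAdjoint, ← map_star, star_one]⟩
  refine ⟨f₀ 1, hp, ?_, ?_⟩
  · have h : φ = fun y => e (y, 0) := funext fun y => by simp only [e, ha0]
    rw [hf₀, ← starProjection_span_eq_sandwich he₀, wannierProj, h]
  · rw [← OperatorK.K0.map_ofProj f₀ 1 hone _ hp rfl, hz]

end Wannier

end Roe

end

theorem theorem3p2 {D : Type*} [MetricSpace D] [MeasurableSpace D] [BorelSpace D]
    (hD : Roe.UniformlyDiscrete D) (hB : Roe.BoundedGeometry D) (hR : Roe.HasRayStructure D) :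
    (∀ (H : Type*) [NormedAddCommGroup H] [InnerProductSpace ℂ H] [CompleteSpace H],
      ¬ FiniteDimensional ℂ H → ∀ V : ℂ →ₗᵢ[ℂ] H,
        (∀ p ∈ (Roe.gamma hD).range, Roe.iStar Measure.count V p = 0) ∧
        Roe.iStar Measure.count V
          (OperatorK.K0.ofProj (Roe.unit hD) (Roe.isStarProjection_unit hD)) = 0) ∧
    (∀ (X : Type*) [MetricSpace X] [ProperSpace X] [MeasurableSpace X] [BorelSpace X]
      (μ : Measure X) [NullSingletonClass μ] (ι : D → X), Isometry ι →
      ∀ φ : D → Lp ℂ 2 μ, Roe.IsWannierBasis ι φ →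
        ∃ (p : Roe.RoeAlgebra μ ℂ) (hp : IsStarProjection p),
          Roe.RoeAlg.op _ p = Roe.wannierProj φ ∧ OperatorK.K0.ofProj p hp = 0) := by
  have := hD.discreteTopology
  refine ⟨fun H _ _ _ hH V => ?_, fun X _ _ _ _ μ _ ι hι φ hφ => hφ.exists_proj hD hB hR hι⟩
  have h : ∀ p ∈ (Roe.gamma hD).range, Roe.iStar Measure.count V p = 0 := by
    rintro _ ⟨z, rfl⟩
    exact Roe.iStar_gamma_eq_zero hD hB hR hH V z
  exact ⟨h, h _ (Roe.unit_mem_range_gamma hD)⟩
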